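/- **Setting.** Let $I=[0,\infty[$, and let $\varepsilon\in C^2(I,[0,\infty[)$, $C\in C^1(I,]0,\infty[)$, $F\in C^1(\mathbb R)$, $a'\in\mathbb R$ and a real function $a=a(x,t,u,u_x,u_t,u_{xx})$ be given. For $t_0\ge 0$ consider the problem $$-\varepsilon(t)u_{xxt}+u_{tt}-C(t)u_{xx}+(a'+a)u_t=F(u)\quad (0<x<\pi,\ t>t_0),\qquad u(0,t)=u(\pi,t)=0,$$ with initial data $u(\cdot,t_0)=u_0$, $u_t(\cdot,t_0)=u_1$. Its solutions are classical solutions on $[0,\pi]\times[t_0,\infty[$: $u,u_x,u_{xx},u_t$ are continuous for $t\ge t_0$, and $u_{xt},u_{tt},\varepsilon u_{xxt}$ are continuous on $[0,\pi]\times\,]t_0,\infty[$ (where $u_{xxt}$ needs to exist only if $\varepsilon(t)\ne0$, and $\varepsilon u_{xxt}:=0$ otherwise). Write $\overline f=\inf_{t>0}f(t)$, $\overline{\overline f}=\sup_{t>0}f(t)$, let $$d^2(\varphi,\psi,t)=\int_0^\pi\big[\varepsilon^2(t)\varphi_{xx}^2+\varphi_x^2+\varphi^2+\psi^2\big]\,dx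 ,$$ and for a solution $u$ let $d(t)=d(u(\cdot,t),u_t(\cdot,t),t)$. **Assumptions.** There are constants $k,h,A\ge0$ and $\omega,\rho,\mu,\tau>0$ such that - $F(0)=0$, and $F'(z)\le k+h|z|^\omega$ if $|z|<\rho$; - $\overline C>k$, $\;C-\dot\varepsilon\ge\mu(1+\varepsilon)$ on $I$, $\;\mu+\overline C/2-2k>0$, $\;\overline{\ddot\varepsilon}>-\infty$; - $a'+\overline\varepsilon/2>0$, and $0\le a(x,t,\varphi(x),\varphi_x(x),\psi(x),\varphi_{xx}(x))\le A\,d(\varphi,\psi,t)^\tau$ for all $t\in I$, $x\in\,]0,\pi[$, and all $\varphi\in C^2([0,\pi])$, $\psi\in C([0,\pi])$ vanishing at $0$ and $\pi$. Moreover either $\dot C\le0$ on $I$, or $\dot C(t)\to0$ as $t\to\infty$. **Notation.** Let $g=C-\dot\varepsilon/2+1$, let $$\theta_1=\max\Big\{2a',\ \tfrac{2k}{\mu}-a',\ \tfrac{5-\overline{\ddot\varepsilon}-a'(\mu-\overline C)}{\mu+\overline C/2-2k}\Big\},\qquad \theta_2=\max\Big\{\theta_1,\ \tfrac{\overline C+5/4}{a'+\overline\varepsilon/2}\Big\},$$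 fix any $\theta>\theta_2$, and for $\sigma>0$ put $$\gamma_3(\sigma)=\tfrac{1+\theta}{a'+\overline\varepsilon}+\theta^2+2+\tfrac{a'+\theta}{\mu}+(a'+1)\theta+\tfrac{A^2}{a'+\overline\varepsilon}\Big(\tfrac1\mu+\tfrac{\theta}{\overline C}\Big)\sigma^{2\tau},\qquad m(\sigma)=\max_{|\zeta|\le\sigma}|F'(\zeta)|,$$ $$\lambda(\sigma)=\frac{\min\{1,\frac34\mu\}}{[1+m(\sigma)][1+\gamma_3(\sigma)]},\qquad G(\sigma)=h\int_0^\infty e^{-\frac{\omega\lambda(\sigma)}2\int_0^t\frac{ds}{g(s)}}g(t)\,dt\in[0,\infty]$$ (with $G\equiv0$ if $h=0$), and $\sigma'_M=\sup\{\sigma>0:\ G(\sigma)<\infty\}$, the supremum of the empty set being $0$. **Stability notions.** Given $\kappa\ge0$ and $\xi>0$, the null solution is - *stable* if for all $\sigma\in\,]0,\xi]$ and $t_0\ge\kappa$ there is $\delta(\sigma,t_0)>0$ such that every solution on $[t_0,\infty[$ with $d(t_0)<\delta$ satisfies $d(t)<\sigma$ for all $t\ge t_0$; *uniformly stable* if $\delta$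 can be chosen independent of $t_0$; - *asymptotically stable* if it is stable and for every $t_0\ge\kappa$ there is $\delta(t_0)>0$ such that for all $\nu>0$ and all initial data $(u_0,u_1)$ there is $T(\nu,t_0,u_0,u_1)>0$ such that every solution on $[t_0,\infty[$ with these data and $d(t_0)<\delta$ satisfies $d(t)<\nu$ for all $t\ge t_0+T$; - *uniformly exponential-asymptotically stable* if there are $\delta,D,E>0$ such that for all $t_0\ge\kappa$ every solution on $[t_0,\infty[$ with $d(t_0)<\delta$ satisfies $d(t)\le D\,e^{-E(t-t_0)}d(t_0)$ for all $t\ge t_0$. **Theorem 1.** There are $\kappa\ge0$ and $\xi>0$, with $\kappa=0$ if $\dot C\le0$ on $I$, such that the following hold. 1. If $\sigma'_M>0$, the null solution is stable. 2. If moreover $\int_0^\infty\frac{dt}{g(t)}=\infty$, the null solution is asymptotically stable. 3. If $\overline{\overline g}<\infty$, the null solution is uniformly stable and uniformly exponential-asymptotically stable. -/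

import Mathlib

open Set MeasureTheory Filter Topology

noncomputable section

namespace StrongDamping

/-- Infimum of a real function over the times `t > 0`. -/
def infPos (f : ℝ → ℝ) : ℝ := sInf (f '' Ioi 0)

/-- First derivative on the time half-line `I = [0, ∞)` (one-sided at `0`). -/
def ddt (f : ℝ → ℝ) : ℝ → ℝ := derivWithin f (Ici 0)

/-- Derivative of a function on the closed space interval `[0, π]` (one-sided at the ends). -/
def ddx (φ : ℝ → ℝ) : ℝ → ℝ := derivWithin φ (Icc 0 Real.pi)

/-- Partial derivative in `x ∈ [0, π]` of `u = u(x, t)`. -/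
def Dx (u : ℝ → ℝ → ℝ) : ℝ → ℝ → ℝ := fun x t => ddx (fun y => u y t) x

/-- Partial derivative in `t ∈ [t₀, ∞)` of `u = u(x, t)`. -/
def Dt (t₀ : ℝ) (u : ℝ → ℝ → ℝ) : ℝ → ℝ → ℝ := fun x t => derivWithin (u x) (Ici t₀) t

/-- The data of the equation
`-ε(t) u_xxt + u_tt - C(t) u_xx + (a' + a) u_t = F(u)`,
where `a = a(x, t, u, u_x, u_t, u_xx)`. -/
structure Problem where
  ε : ℝ → ℝ
  C : ℝ → ℝ
  F : ℝ → ℝ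
  a' : ℝ
  a : ℝ → ℝ → ℝ → ℝ → ℝ → ℝ → ℝ

/-- The constants occurring in the assumptions on the data. -/
structure Constants where
  k : ℝ
  h : ℝ
  A : ℝ
  ω : ℝ
  ρ : ℝ
  μ : ℝ
  τ : ℝ

namespace Problem

variable (P : Problem) (c : Constants)

/-- The weighted norm `d(φ, ψ, t)`. -/
def d (φ ψ : ℝ → ℝ) (t : ℝ) : ℝ :=
  Real.sqrt (∫ x in (0 : ℝ)..Real.pi,
    (P.ε t ^ 2 * ddx (ddx φ) x ^ 2 + ddx φ x ^ 2 + φ x ^ 2 + ψ x ^ 2))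

/-- The distance `d(t) = d(u(·, t), u_t(·, t), t)` of `u`, given on `[t₀, ∞)`, from the null
solution. -/
def dist (t₀ : ℝ) (u : ℝ → ℝ → ℝ) (t : ℝ) : ℝ :=
  P.d (fun x => u x t) (fun x => Dt t₀ u x t) t

/-- Classical solutions on `[0, π] × [t₀, ∞)` of the equation with Dirichlet conditions.
The functions `u, u_x, u_xx, u_t` are continuous up to the initial time, while `u_xt`, `u_tt` and
`ε u_xxt` are continuous for `t > t₀`; `u_xxt` has to exist only where its coefficient `ε` does
not vanish. -/
structure IsSolution (t₀ : ℝ) (u : ℝ → ℝ → ℝ) : Prop where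
  diff_x : ∀ t ∈ Ici t₀, DifferentiableOn ℝ (fun x => u x t) (Icc 0 Real.pi)
  diff_xx : ∀ t ∈ Ici t₀, DifferentiableOn ℝ (fun x => Dx u x t) (Icc 0 Real.pi)
  diff_t : ∀ x ∈ Icc 0 Real.pi, DifferentiableOn ℝ (u x) (Ici t₀)
  diff_xt : ∀ t ∈ Ioi t₀, DifferentiableOn ℝ (fun x => Dt t₀ u x t) (Icc 0 Real.pi)
  diff_tt : ∀ x ∈ Icc 0 Real.pi, DifferentiableOn ℝ (Dt t₀ u x) (Ioi t₀)
  diff_xxt : ∀ x ∈ Icc 0 Real.pi, ∀ t ∈ Ioi t₀, P.ε t ≠ 0 →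
    DifferentiableAt ℝ (Dx (Dx u) x) t
  cont : ContinuousOn (fun p : ℝ × ℝ => u p.1 p.2) (Icc 0 Real.pi ×ˢ Ici t₀)
  cont_x : ContinuousOn (fun p : ℝ × ℝ => Dx u p.1 p.2) (Icc 0 Real.pi ×ˢ Ici t₀)
  cont_xx : ContinuousOn (fun p : ℝ × ℝ => Dx (Dx u) p.1 p.2) (Icc 0 Real.pi ×ˢ Ici t₀)
  cont_t : ContinuousOn (fun p : ℝ × ℝ => Dt t₀ u p.1 p.2) (Icc 0 Real.pi ×ˢ Ici t₀)
  cont_xt : ContinuousOn (fun p : ℝ × ℝ => Dx (Dt t₀ u) p.1 p.2) (Icc 0 Real.pi ×ˢ Ioi t₀)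
  cont_tt : ContinuousOn (fun p : ℝ × ℝ => Dt t₀ (Dt t₀ u) p.1 p.2) (Icc 0 Real.pi ×ˢ Ioi t₀)
  cont_xxt : ContinuousOn (fun p : ℝ × ℝ => P.ε p.2 * Dt t₀ (Dx (Dx u)) p.1 p.2)
    (Icc 0 Real.pi ×ˢ Ioi t₀)
  boundary : ∀ t ∈ Ici t₀, u 0 t = 0 ∧ u Real.pi t = 0
  equation : ∀ x ∈ Ioo 0 Real.pi, ∀ t ∈ Ioi t₀,
    -(P.ε t * Dt t₀ (Dx (Dx u)) x t) + Dt t₀ (Dt t₀ u) x t - P.C t * Dx (Dx u) x t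
      + (P.a' + P.a x t (u x t) (Dx u x t) (Dt t₀ u x t) (Dx (Dx u) x t)) * Dt t₀ u x t
      = P.F (u x t)

/-- The null solution is stable (initial times `t₀ ≥ κ`, errors `σ ∈ (0, ξ]`). -/
def Stable (κ ξ : ℝ) : Prop :=
  ∀ σ ∈ Ioc 0 ξ, ∀ t₀ ∈ Ici κ, ∃ δ : ℝ, 0 < δ ∧
    ∀ u : ℝ → ℝ → ℝ, P.IsSolution t₀ u → P.dist t₀ u t₀ < δ →
      ∀ t ∈ Ici t₀, P.dist t₀ u t < σ

/-- The null solution is uniformly stable: `δ` does not depend on `t₀`. -/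
def UniformlyStable (κ ξ : ℝ) : Prop :=
  ∀ σ ∈ Ioc 0 ξ, ∃ δ : ℝ, 0 < δ ∧ ∀ t₀ ∈ Ici κ,
    ∀ u : ℝ → ℝ → ℝ, P.IsSolution t₀ u → P.dist t₀ u t₀ < δ →
      ∀ t ∈ Ici t₀, P.dist t₀ u t < σ

/-- The null solution is asymptotically stable: it is stable, and solutions starting in a
`δ(t₀)`-neighbourhood tend to zero, the time `T` depending on `ν`, `t₀` and the initial data
`u₀, u₁`. -/
def AsymptoticallyStable (κ ξ : ℝ) : Prop :=
  P.Stable κ ξ ∧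
  ∀ t₀ ∈ Ici κ, ∃ δ : ℝ, 0 < δ ∧ ∀ ν : ℝ, 0 < ν → ∀ u₀ u₁ : ℝ → ℝ, ∃ T : ℝ, 0 < T ∧
    ∀ u : ℝ → ℝ → ℝ, P.IsSolution t₀ u →
      (∀ x ∈ Icc 0 Real.pi, u x t₀ = u₀ x ∧ Dt t₀ u x t₀ = u₁ x) →
      P.dist t₀ u t₀ < δ → ∀ t ∈ Ici (t₀ + T), P.dist t₀ u t < ν

/-- The null solution is uniformly exponential-asymptotically stable. -/
def UniformlyExpStable (κ : ℝ) : Prop :=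
  ∃ δ D E : ℝ, 0 < δ ∧ 0 < D ∧ 0 < E ∧ ∀ t₀ ∈ Ici κ,
    ∀ u : ℝ → ℝ → ℝ, P.IsSolution t₀ u → P.dist t₀ u t₀ < δ →
      ∀ t ∈ Ici t₀, P.dist t₀ u t ≤ D * Real.exp (-(E * (t - t₀))) * P.dist t₀ u t₀

/-- The assumptions on the data and on the constants. -/
structure Assumptions : Prop where
  ε_smooth : ContDiffOn ℝ 2 P.ε (Ici 0)
  ε_nonneg : ∀ t ∈ Ici (0 : ℝ), 0 ≤ P.ε t
  C_smooth : ContDiffOn ℝ 1 P.C (Ici 0)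
  C_pos : ∀ t ∈ Ici (0 : ℝ), 0 < P.C t
  F_smooth : ContDiff ℝ 1 P.F
  k_nonneg : 0 ≤ c.k
  h_nonneg : 0 ≤ c.h
  A_nonneg : 0 ≤ c.A
  ω_pos : 0 < c.ω
  ρ_pos : 0 < c.ρ
  μ_pos : 0 < c.μ
  τ_pos : 0 < c.τ
  F_zero : P.F 0 = 0
  F_deriv : ∀ z : ℝ, |z| < c.ρ → deriv P.F z ≤ c.k + c.h * |z| ^ c.ω
  C_gt : c.k < infPos P.C
  C_sub : ∀ t ∈ Ici (0 : ℝ), c.μ * (1 + P.ε t) ≤ P.C t - ddt P.ε t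
  gap : 0 < c.μ + infPos P.C / 2 - 2 * c.k
  ε_ddot : BddBelow (ddt (ddt P.ε) '' Ioi 0)
  a_bound : ∀ t ∈ Ici (0 : ℝ), ∀ φ ψ : ℝ → ℝ,
    ContDiffOn ℝ 2 φ (Icc 0 Real.pi) → ContinuousOn ψ (Icc 0 Real.pi) →
    φ 0 = 0 → φ Real.pi = 0 → ψ 0 = 0 → ψ Real.pi = 0 → ∀ x ∈ Ioo 0 Real.pi,
      0 ≤ P.a x t (φ x) (ddx φ x) (ψ x) (ddx (ddx φ) x) ∧
      P.a x t (φ x) (ddx φ x) (ψ x) (ddx (ddx φ) x) ≤ c.A * P.d φ ψ t ^ c.τ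
  a'_bound : 0 < P.a' + infPos P.ε / 2

/-- The function `g = C - ε̇ / 2 + 1`. -/
def g (t : ℝ) : ℝ := P.C t - ddt P.ε t / 2 + 1

def θ₁ : ℝ :=
  max (2 * P.a') (max (2 * c.k / c.μ - P.a')
    ((5 - infPos (ddt (ddt P.ε)) - P.a' * (c.μ - infPos P.C)) /
      (c.μ + infPos P.C / 2 - 2 * c.k)))

def θ₂ : ℝ := max (P.θ₁ c) ((infPos P.C + 5 / 4) / (P.a' + infPos P.ε / 2))

def γ₃₂ (θ : ℝ) : ℝ := c.A ^ 2 / (P.a' + infPos P.ε) * (1 / c.μ + θ / infPos P.C)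

def γ₃₁ (θ : ℝ) : ℝ :=
  (1 + θ) / (P.a' + infPos P.ε) + θ ^ 2 + 2 + (P.a' + θ) / c.μ + (P.a' + 1) * θ

def γ₃ (θ σ : ℝ) : ℝ := P.γ₃₁ c θ + P.γ₃₂ c θ * σ ^ (2 * c.τ)

/-- `m(r) = max {|F'(ζ)| : |ζ| ≤ r}`. -/
def m (r : ℝ) : ℝ := sSup ((fun ζ => |deriv P.F ζ|) '' Icc (-r) r)

def rate (θ σ : ℝ) : ℝ := min 1 (3 / 4 * c.μ) / ((1 + P.m σ) * (1 + P.γ₃ c θ σ))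

/-- `G(σ) = h ∫₀^∞ exp (-(ω λ(σ) / 2) ∫₀^t ds / g(s)) g(t) dt`, with values in `[0, ∞]`. -/
def G (θ σ : ℝ) : ENNReal :=
  ENNReal.ofReal c.h * ∫⁻ t in Ioi (0 : ℝ),
    ENNReal.ofReal (Real.exp (-(c.ω * P.rate c θ σ / 2 * ∫ s in (0 : ℝ)..t, 1 / P.g s)) * P.g t)

/-- `σ'_M = sup {σ > 0 : G(σ) < ∞}`, with values in `[0, ∞]`. -/
def σM' (θ : ℝ) : ENNReal :=
  sSup (ENNReal.ofReal '' {σ : ℝ | 0 < σ ∧ P.G c θ σ < ⊤})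

end Problem

end StrongDamping

end

/-!
# Stability of the null solution of a strongly damped nonlinear wave equation

The proof is Liapunov's direct method. For `v = u_t` and positive weights `γ`, `θ` the functional
`W = ½ ∫ [(ε u_xx - v)² + γ v² + 2 θ u v + (C (1 + γ) - ε' + ε (a' + θ)) u_x² + a' θ u²]
- (1 + γ) ∫ ∫₀ᵘ F` is chosen so that the indefinite terms `u_x v_x`, `u v` and `F(u) v` cancel in
its derivative along a solution (`IsSolution.hasDerivAt_energy`). For a solution with `d ≤ σ`, and
with the weight `γ = γ₃(σ)`, three estimates hold.

* `lower_mul_le_liapunov`: `W ≥ χ d²` with a constant `χ > 0`.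
* `liapunov_le`: `W ≤ (1 + m(σ)) (1 + γ₃(σ)) g d²`.
* `IsSolution.exists_deriv_energy_le`: `W' ≤ - min {1, 3 μ / 4} d² + const · h d^ω g d²`.

They rest on Wirtinger's inequality with the sharp constant (`HasContDeriv.integral_sq_le`), on the
embedding `sup |u|² ≤ ∫ u_x²`, and on Young's inequality for the nonlinear damping. Together they
give `W' ≤ -(λ / g) W + const · h g W^(1 + ω / 2)`, where `λ = λ(σ)`. As long as
`W e^{λ ∫ ds / g} < S`, the last term is at most `const · S^(ω / 2) h g e^{-(ω λ / 2) ∫ ds / g} W`,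
whose coefficient has a finite time integral precisely when `G(σ) < ∞`. For small `S` Grönwall's
argument shows that `W e^{λ ∫ ds / g}` at most doubles, so the bound `S` is never attained if it is
not at the beginning (`IsSolution.dist_lt_and_sq_le`). Hence `d² ≤ const · e^{-λ ∫ ds / g}`, with
`d < σ` throughout. The three assertions are read off from this estimate: if `g` is bounded, the
time integral above is bounded independently of `t₀` and `∫ ds / g` grows linearly.

Classical solutions are not assumed to have all the derivatives used formally. The equality
`∂ₜ u_x = ∂ₓ u_t` is proved in `IsSolution.hasDerivAt_Dx`; `ε u_xx` is differentiable in time even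
where `ε` vanishes, since `ε` has a minimum there (`IsSolution.hasDerivAt_ε_mul`);
and `u_xxt = ∂ₓₓ u_t` is needed only in the weak form `IsSolution.integral_mul_ε_Dt`. The function
`a` enters only through the product `a u_t`, which the equation expresses by functions that are
continuous up to the boundary (`damping`).
-/

noncomputable section

namespace StrongDamping

/-! ### Calculus on an interval -/

/-- `φ` is continuously differentiable on `[a, b]` with derivative `φ'`: the derivative is required
in the open interval only, and `φ'` is its continuous extension. -/
structure HasContDeriv (φ φ' : ℝ → ℝ) (a b : ℝ) : Prop where
  cont : ContinuousOn φ (Icc a b)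
  cont_deriv : ContinuousOn φ' (Icc a b)
  deriv : ∀ x ∈ Ioo a b, HasDerivAt φ (φ' x) x

theorem intervalIntegrable_of_Icc {f : ℝ → ℝ} {a b : ℝ} (hab : a ≤ b)
    (hf : ContinuousOn f (Icc a b)) : IntervalIntegrable f volume a b :=
  ContinuousOn.intervalIntegrable (by rwa [uIcc_of_le hab])

theorem HasContDeriv.integral_deriv {φ φ' : ℝ → ℝ} {a b : ℝ} (h : HasContDeriv φ φ' a b)
    (hab : a ≤ b) : ∫ x in a..b, φ' x = φ b - φ a :=
  intervalIntegral.integral_eq_sub_of_hasDerivAt_of_le hab h.cont h.deriv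
    (intervalIntegrable_of_Icc hab h.cont_deriv)

/-- Integration by parts against a function vanishing at both ends. -/
theorem HasContDeriv.integral_mul_deriv {φ φ' ψ ψ' : ℝ → ℝ} {a b : ℝ}
    (hφ : HasContDeriv φ φ' a b) (hψ : HasContDeriv ψ ψ' a b) (hab : a ≤ b)
    (ha : φ a = 0) (hb : φ b = 0) :
    ∫ x in a..b, φ x * ψ' x = -∫ x in a..b, φ' x * ψ x := by
  have h : HasContDeriv (fun x => φ x * ψ x) (fun x => φ' x * ψ x + φ x * ψ' x) a b :=
    ⟨hφ.cont.mul hψ.cont, (hφ.cont_deriv.mul hψ.cont).add (hφ.cont.mul hψ.cont_deriv),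
      fun x hx => (hφ.deriv x hx).mul (hψ.deriv x hx)⟩
  have h1 := h.integral_deriv hab
  rw [intervalIntegral.integral_add
    (intervalIntegrable_of_Icc hab (hφ.cont_deriv.fun_mul hψ.cont))
    (intervalIntegrable_of_Icc hab (hφ.cont.fun_mul hψ.cont_deriv))] at h1
  simp only [ha, hb, zero_mul, sub_zero] at h1
  linarith

theorem integral_mono_Icc {f g : ℝ → ℝ} {a b : ℝ} (hab : a ≤ b) (hf : ContinuousOn f (Icc a b))
    (hg : ContinuousOn g (Icc a b)) (h : ∀ x ∈ Ioo a b, f x ≤ g x) :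
    ∫ x in a..b, f x ≤ ∫ x in a..b, g x :=
  intervalIntegral.integral_mono_on_of_le_Ioo hab (intervalIntegrable_of_Icc hab hf)
    (intervalIntegrable_of_Icc hab hg) h

/-- Wirtinger's inequality with a constant `k < 1`. With `T x = k tan (k (x - π / 2))`, which is
smooth on `[0, π]` because `k < 1`, one has
`(φ')² - k² φ² = (φ' + T φ)² - (T φ²)'`. -/
theorem HasContDeriv.mul_integral_sq_le {φ φ' : ℝ → ℝ} (hφ : HasContDeriv φ φ' 0 Real.pi)
    (h0 : φ 0 = 0) (hπ : φ Real.pi = 0) {k : ℝ} (hk0 : 0 ≤ k) (hk1 : k < 1) :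
    k ^ 2 * ∫ x in (0 : ℝ)..Real.pi, φ x ^ 2 ≤ ∫ x in (0 : ℝ)..Real.pi, φ' x ^ 2 := by
  have hπ0 := Real.pi_pos
  set T : ℝ → ℝ := fun x => k * Real.tan (k * (x - Real.pi / 2)) with hT
  have hcos : ∀ x ∈ Icc 0 Real.pi, Real.cos (k * (x - Real.pi / 2)) ≠ 0 := by
    intro x hx
    refine (Real.cos_pos_of_mem_Ioo ⟨?_, ?_⟩).ne' <;> nlinarith [hx.1, hx.2]
  have hTd : ∀ x ∈ Icc 0 Real.pi, HasDerivAt T (k ^ 2 + T x ^ 2) x := by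
    intro x hx
    have h1 := (Real.hasDerivAt_tan (hcos x hx)).comp x
      (((hasDerivAt_id x).sub_const (Real.pi / 2)).const_mul k)
    refine (h1.const_mul k).congr_deriv ?_
    have h2 := Real.inv_one_add_tan_sq (hcos x hx)
    have h3 : 1 / Real.cos (k * (x - Real.pi / 2)) ^ 2
        = 1 + Real.tan (k * (x - Real.pi / 2)) ^ 2 := by
      rw [← h2, one_div, inv_inv]
    simp only [id] at *
    rw [h3, hT]
    ring
  have hTc : ContinuousOn T (Icc 0 Real.pi) := fun x hx =>
    (hTd x hx).continuousAt.continuousWithinAt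
  have h : HasContDeriv (fun x => T x * φ x ^ 2)
      (fun x => (k ^ 2 + T x ^ 2) * φ x ^ 2 + T x * (2 * φ x * φ' x)) 0 Real.pi := by
    refine ⟨hTc.mul (hφ.cont.pow 2), ?_, fun x hx => ?_⟩
    · exact (((continuousOn_const.add (hTc.pow 2)).mul (hφ.cont.pow 2))).add
        (hTc.mul ((continuousOn_const.mul hφ.cont).mul hφ.cont_deriv))
    · refine ((hTd x (Ioo_subset_Icc_self hx)).mul ((hφ.deriv x hx).pow 2)).congr_deriv ?_
      simp
  have h1 := h.integral_deriv hπ0.le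
  simp only [h0, hπ] at h1
  have h2 : ∫ x in (0 : ℝ)..Real.pi, (k ^ 2 * φ x ^ 2 - φ' x ^ 2) ≤
      ∫ x in (0 : ℝ)..Real.pi, ((k ^ 2 + T x ^ 2) * φ x ^ 2 + T x * (2 * φ x * φ' x)) -
        (0 : ℝ) := by
    simp only [sub_zero]
    refine integral_mono_Icc hπ0.le ?_ h.cont_deriv fun x hx => ?_
    · exact (continuousOn_const.mul (hφ.cont.pow 2)).sub (hφ.cont_deriv.pow 2)
    · nlinarith [sq_nonneg (φ' x + T x * φ x)]
  simp only [sub_zero] at h2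
  rw [h1, intervalIntegral.integral_sub
    (intervalIntegrable_of_Icc hπ0.le (continuousOn_const.fun_mul (hφ.cont.fun_pow 2)))
    (intervalIntegrable_of_Icc hπ0.le (hφ.cont_deriv.fun_pow 2)),
    intervalIntegral.integral_const_mul] at h2
  linarith

/-- Wirtinger's inequality, with the sharp constant, for functions vanishing at `0` and `π`. -/
theorem HasContDeriv.integral_sq_le {φ φ' : ℝ → ℝ} (hφ : HasContDeriv φ φ' 0 Real.pi)
    (h0 : φ 0 = 0) (hπ : φ Real.pi = 0) :
    ∫ x in (0 : ℝ)..Real.pi, φ x ^ 2 ≤ ∫ x in (0 : ℝ)..Real.pi, φ' x ^ 2 := by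
  have h1 : Tendsto (fun k : ℝ => k ^ 2 * ∫ x in (0 : ℝ)..Real.pi, φ x ^ 2) (𝓝[<] 1)
      (𝓝 (1 ^ 2 * ∫ x in (0 : ℝ)..Real.pi, φ x ^ 2)) :=
    tendsto_nhdsWithin_of_tendsto_nhds
      (Continuous.tendsto (f := fun k : ℝ => k ^ 2 * ∫ x in (0 : ℝ)..Real.pi, φ x ^ 2)
        (by fun_prop) 1)
  rw [one_pow, one_mul] at h1
  refine le_of_tendsto h1 ?_
  have h2 : Ioo (0 : ℝ) 1 ∈ 𝓝[<] (1 : ℝ) := Ioo_mem_nhdsLT one_pos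
  filter_upwards [h2] with k hk
  exact hφ.mul_integral_sq_le h0 hπ hk.1.le hk.2

/-- The second derivative dominates the first one in `L²`. -/
theorem HasContDeriv.integral_deriv_sq_le {φ φ' φ'' : ℝ → ℝ} (hφ : HasContDeriv φ φ' 0 Real.pi)
    (hφ' : HasContDeriv φ' φ'' 0 Real.pi) (h0 : φ 0 = 0) (hπ : φ Real.pi = 0) :
    ∫ x in (0 : ℝ)..Real.pi, φ' x ^ 2 ≤ ∫ x in (0 : ℝ)..Real.pi, φ'' x ^ 2 := by
  have hπ0 := Real.pi_pos.le
  have h1 := hφ.integral_mul_deriv hφ' hπ0 h0 hπ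
  have h2 := hφ.integral_sq_le h0 hπ
  have h3 : ∫ x in (0 : ℝ)..Real.pi, φ' x * φ' x = ∫ x in (0 : ℝ)..Real.pi, φ' x ^ 2 := by
    simp only [sq]
  have h4 : ∫ x in (0 : ℝ)..Real.pi, (-2) * (φ x * φ'' x) ≤
      ∫ x in (0 : ℝ)..Real.pi, (φ x ^ 2 + φ'' x ^ 2) := by
    refine integral_mono_Icc hπ0 (continuousOn_const.mul (hφ.cont.mul hφ'.cont_deriv))
      ((hφ.cont.pow 2).add (hφ'.cont_deriv.pow 2)) fun x _ => ?_
    nlinarith [sq_nonneg (φ x + φ'' x)]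
  rw [intervalIntegral.integral_const_mul, intervalIntegral.integral_add
    (intervalIntegrable_of_Icc hπ0 (hφ.cont.fun_pow 2))
    (intervalIntegrable_of_Icc hπ0 (hφ'.cont_deriv.fun_pow 2))] at h4
  linarith

/-- The sup norm of a function vanishing at `0` and `π` is at most the `L²` norm of its
derivative. Both `|φ x| ≤ ∫₀ˣ |φ'|` and `|φ x| ≤ ∫ₓ^π |φ'|` are used, so that the constant is
`π / 4 ≤ 1`. -/
theorem HasContDeriv.sq_le_integral {φ φ' : ℝ → ℝ} (hφ : HasContDeriv φ φ' 0 Real.pi)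
    (h0 : φ 0 = 0) (hπ : φ Real.pi = 0) {x : ℝ} (hx : x ∈ Icc 0 Real.pi) :
    φ x ^ 2 ≤ ∫ y in (0 : ℝ)..Real.pi, φ' y ^ 2 := by
  have hπ0 := Real.pi_pos
  have hsub1 : Icc 0 x ⊆ Icc 0 Real.pi := Icc_subset_Icc_right hx.2
  have hsub2 : Icc x Real.pi ⊆ Icc 0 Real.pi := Icc_subset_Icc_left hx.1
  have h1 : ∫ y in (0 : ℝ)..x, φ' y = φ x - φ 0 :=
    HasContDeriv.integral_deriv ⟨hφ.cont.mono hsub1, hφ.cont_deriv.mono hsub1,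
      fun y hy => hφ.deriv y ⟨hy.1, hy.2.trans_le hx.2⟩⟩ hx.1
  have h2 : ∫ y in x..Real.pi, φ' y = φ Real.pi - φ x :=
    HasContDeriv.integral_deriv ⟨hφ.cont.mono hsub2, hφ.cont_deriv.mono hsub2,
      fun y hy => hφ.deriv y ⟨hx.1.trans_lt hy.1, hy.2⟩⟩ hx.2
  have h3 : |φ x| ≤ ∫ y in (0 : ℝ)..x, |φ' y| := by
    rw [show φ x = ∫ y in (0 : ℝ)..x, φ' y by rw [h1, h0, sub_zero]]
    exact intervalIntegral.abs_integral_le_integral_abs hx.1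
  have h4 : |φ x| ≤ ∫ y in x..Real.pi, |φ' y| := by
    rw [show φ x = -∫ y in x..Real.pi, φ' y by rw [h2, hπ]; ring, abs_neg]
    exact intervalIntegral.abs_integral_le_integral_abs hx.2
  have habs : ContinuousOn (fun y => |φ' y|) (Icc 0 Real.pi) := hφ.cont_deriv.abs
  have h5 := intervalIntegral.integral_add_adjacent_intervals
    (intervalIntegrable_of_Icc hx.1 (habs.mono hsub1))
    (intervalIntegrable_of_Icc hx.2 (habs.mono hsub2))
  set l := ∫ y in (0 : ℝ)..Real.pi, |φ' y| with hl
  set Y := ∫ y in (0 : ℝ)..Real.pi, φ' y ^ 2 with hY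
  have h6 : ∫ y in (0 : ℝ)..Real.pi, (2 * (l / Real.pi)) * |φ' y| ≤
      ∫ y in (0 : ℝ)..Real.pi, (φ' y ^ 2 + (l / Real.pi) ^ 2) := by
    refine integral_mono_Icc hπ0.le (continuousOn_const.mul habs)
      ((hφ.cont_deriv.pow 2).add continuousOn_const) fun y _ => ?_
    nlinarith [sq_nonneg (|φ' y| - l / Real.pi), sq_abs (φ' y)]
  rw [intervalIntegral.integral_const_mul, intervalIntegral.integral_add
    (intervalIntegrable_of_Icc hπ0.le (hφ.cont_deriv.fun_pow 2))
    intervalIntegrable_const, intervalIntegral.integral_const,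
    ← hl, ← hY, sub_zero, smul_eq_mul] at h6
  have h7 : l ^ 2 ≤ Real.pi * Y := by
    have : 2 * (l / Real.pi) * l = 2 * l ^ 2 / Real.pi := by ring
    have h' : Real.pi * (l / Real.pi) ^ 2 = l ^ 2 / Real.pi := by field_simp
    rw [this, h'] at h6
    have h8 : l ^ 2 / Real.pi ≤ Y := by
      have : 2 * l ^ 2 / Real.pi = 2 * (l ^ 2 / Real.pi) := by ring
      linarith
    rwa [div_le_iff₀ hπ0, mul_comm] at h8
  have hY0 : 0 ≤ Y := intervalIntegral.integral_nonneg hπ0.le fun y _ => sq_nonneg _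
  have h9 : 2 * |φ x| ≤ l := by linarith
  have h10 : (2 * |φ x|) ^ 2 ≤ l ^ 2 := pow_le_pow_left₀ (by positivity) h9 2
  have h11 : 4 * φ x ^ 2 ≤ l ^ 2 := by rw [mul_pow, sq_abs] at h10; linarith
  nlinarith [Real.pi_le_four]

/-! ### Integrals depending on a parameter -/

/-- Differentiation under the integral sign. The derivative in the parameter need exist only in the
open interval of integration, provided that it extends continuously to the closed one. -/
theorem hasDerivAt_integral_param {f f' : ℝ → ℝ → ℝ} {a b t : ℝ} {S : Set ℝ} (hab : a ≤ b)
    (hS : IsOpen S) (ht : t ∈ S) (hf : ∀ s ∈ S, ContinuousOn (fun x => f x s) (Icc a b))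
    (hf' : ContinuousOn (fun p : ℝ × ℝ => f' p.1 p.2) (Icc a b ×ˢ S))
    (hd : ∀ x ∈ Ioo a b, ∀ s ∈ S, HasDerivAt (f x) (f' x s) s) :
    HasDerivAt (fun s => ∫ x in a..b, f x s) (∫ x in a..b, f' x t) t := by
  obtain ⟨r, hr, hrS⟩ := Metric.nhds_basis_closedBall.mem_iff.1 (hS.mem_nhds ht)
  obtain ⟨K, hK⟩ := (isCompact_Icc.prod (isCompact_closedBall t r)).exists_bound_of_continuousOn
    (hf'.mono (prod_mono_right hrS))
  have hae : ∀ᵐ x : ℝ, x ≠ b := by simp [ae_iff, measure_singleton]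
  refine (intervalIntegral.hasDerivAt_integral_of_dominated_loc_of_deriv_le
    (F := fun s x => f x s) (F' := fun s x => f' x s) (bound := fun _ => K)
    (Metric.closedBall_mem_nhds t hr) ?_ ?_ ?_ ?_ ?_ ?_).2
  · filter_upwards [hS.mem_nhds ht] with s hs
    exact (intervalIntegrable_iff.1 (intervalIntegrable_of_Icc hab (hf s hs))).aestronglyMeasurable
  · exact intervalIntegrable_of_Icc hab (hf t ht)
  · refine (intervalIntegrable_iff.1 (intervalIntegrable_of_Icc hab
      (f := fun x => f' x t) ?_)).aestronglyMeasurable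
    exact hf'.comp (f := fun x : ℝ => (x, t)) (by fun_prop) fun x hx => ⟨hx, ht⟩
  · refine Eventually.of_forall fun x hx s hs => ?_
    rw [uIoc_of_le hab] at hx
    exact hK (x, s) ⟨Ioc_subset_Icc_self hx, hs⟩
  · exact intervalIntegrable_const
  · filter_upwards [hae] with x hxb hx s hs
    rw [uIoc_of_le hab] at hx
    exact hd x ⟨hx.1, lt_of_le_of_ne hx.2 hxb⟩ s (hrS hs)

theorem continuousOn_integral_param {f : ℝ → ℝ → ℝ} {a b t₀ : ℝ} (hab : a ≤ b)
    (hf : ContinuousOn (fun p : ℝ × ℝ => f p.1 p.2) (Icc a b ×ˢ Ici t₀)) :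
    ContinuousOn (fun t => ∫ x in a..b, f x t) (Ici t₀) := by
  have h1 : Continuous (Function.uncurry fun t x : ℝ => f (max a (min b x)) (max t₀ t)) := by
    refine hf.comp_continuous (f := fun p : ℝ × ℝ => (max a (min b p.2), max t₀ p.1))
      (by fun_prop) fun p => ⟨⟨le_max_left _ _, max_le hab (min_le_left _ _)⟩, mem_Ici.2 (le_max_left _ _)⟩
  have h2 := intervalIntegral.continuous_parametric_intervalIntegral_of_continuous'
    (μ := volume) h1 a b
  refine h2.continuousOn.congr fun t ht => ?_
  refine intervalIntegral.integral_congr fun x hx => ?_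
  rw [uIcc_of_le hab] at hx
  simp [max_eq_right (show t₀ ≤ t from ht), min_eq_right hx.2, max_eq_right hx.1]

/-! ### Elementary facts -/

/-- If `F 0 = 0` and `F' ≤ K` on `[-s, s]`, then `z F(z) ≤ K z²` there. -/
theorem mul_le_of_deriv_le {F : ℝ → ℝ} (hF : ContDiff ℝ 1 F) (h0 : F 0 = 0) {K s : ℝ}
    (hK : ∀ z : ℝ, |z| ≤ s → deriv F z ≤ K) {z : ℝ} (hz : |z| ≤ s) : z * F z ≤ K * z ^ 2 := by
  have hd : Differentiable ℝ F := hF.differentiable (by norm_num)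
  rcases lt_trichotomy z 0 with h | rfl | h
  · obtain ⟨y, hy, hy'⟩ := exists_deriv_eq_slope F h hd.continuous.continuousOn hd.differentiableOn
    have h1 := hK y (by rw [abs_le] at hz ⊢; constructor <;> linarith [hy.1, hy.2, hz.1])
    rw [hy', h0, div_le_iff₀ (by linarith)] at h1
    nlinarith
  · simp
  · obtain ⟨y, hy, hy'⟩ := exists_deriv_eq_slope F h hd.continuous.continuousOn hd.differentiableOn
    have h1 := hK y (by rw [abs_le] at hz ⊢; constructor <;> linarith [hy.1, hy.2, hz.1])
    rw [hy', h0, div_le_iff₀ (by linarith)] at h1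
    nlinarith

theorem integral_le_of_deriv_le {F : ℝ → ℝ} (hF : ContDiff ℝ 1 F) (h0 : F 0 = 0) {K s : ℝ}
    (hK : ∀ z : ℝ, |z| ≤ s → deriv F z ≤ K) {z : ℝ} (hz : |z| ≤ s) :
    ∫ y in (0 : ℝ)..z, F y ≤ K * z ^ 2 / 2 := by
  have h1 : ∫ y in (0 : ℝ)..z, K * y = K * z ^ 2 / 2 := by
    rw [intervalIntegral.integral_const_mul, integral_id]; ring
  have hc := hF.continuous
  rw [← h1]
  rcases le_total 0 z with h | h
  · refine integral_mono_Icc h hc.continuousOn (by fun_prop) fun y hy => ?_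
    have := mul_le_of_deriv_le hF h0 hK (z := y)
      (by rw [abs_le] at hz ⊢; constructor <;> linarith [hy.1, hy.2, hz.1])
    nlinarith [hy.1]
  · rw [intervalIntegral.integral_symm, intervalIntegral.integral_symm z 0, neg_le_neg_iff]
    refine integral_mono_Icc h (by fun_prop) hc.continuousOn fun y hy => ?_
    have := mul_le_of_deriv_le hF h0 hK (z := y)
      (by rw [abs_le] at hz ⊢; constructor <;> linarith [hy.1, hy.2, hz.1])
    nlinarith [hy.2]

/-- Continuous induction: a strict inequality that propagates to the end of each interval on which
it holds, and holds initially, holds for all times. -/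
theorem lt_of_continuous_induction {f : ℝ → ℝ} {t₀ : ℝ} (hf : ContinuousOn f (Ici t₀))
    (h0 : f t₀ < 0) (h : ∀ t, t₀ < t → (∀ s ∈ Ico t₀ t, f s < 0) → f t < 0) :
    ∀ t ∈ Ici t₀, f t < 0 := by
  by_contra! hne
  obtain ⟨t₁, ht₁, hft₁⟩ := hne
  set B : Set ℝ := Ici t₀ ∩ f ⁻¹' Ici 0 with hB
  have hBc : IsClosed B := hf.preimage_isClosed_of_isClosed isClosed_Ici isClosed_Ici
  have hBb : BddBelow B := ⟨t₀, fun s hs => hs.1⟩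
  have hmem := hBc.csInf_mem ⟨t₁, ht₁, hft₁⟩ hBb
  have hlt : t₀ < sInf B := by
    refine lt_of_le_of_ne hmem.1 fun he => ?_
    have := hmem.2
    rw [← he] at this
    exact absurd h0 (not_lt.2 this)
  refine absurd (h _ hlt fun s hs => ?_) (not_lt.2 hmem.2)
  by_contra! hs'
  exact absurd (csInf_le hBb ⟨hs.1, hs'⟩) (not_le.2 hs.2)

/-- At a zero that is a local minimum the derivative of the coefficient `e` vanishes too, hence the
product with a merely continuous function is differentiable there, with derivative `0`. -/
theorem hasDerivAt_mul_of_isLocalMin {e f : ℝ → ℝ} {t e' : ℝ} (he : HasDerivAt e e' t)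
    (hmin : IsLocalMin e t) (h0 : e t = 0) (hf : ContinuousAt f t) :
    e' = 0 ∧ HasDerivAt (fun s => e s * f s) 0 t := by
  have he' : e' = 0 := hmin.hasDerivAt_eq_zero he
  refine ⟨he', ?_⟩
  subst he'
  rw [hasDerivAt_iff_isLittleO] at he ⊢
  simp only [h0, sub_zero, smul_zero, zero_mul] at he ⊢
  have h1 : f =O[𝓝 t] (fun _ => (1 : ℝ)) := hf.isBigO_one ℝ
  simpa using he.mul_isBigO h1

/-! ### Primitives on a half-line -/

theorem hasDerivAt_primitive {f : ℝ → ℝ} {t₀ t : ℝ} (hf : ContinuousOn f (Ici t₀)) (ht : t₀ < t) :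
    HasDerivAt (fun s => ∫ r in t₀..s, f r) (f t) t := by
  have hf' : ContinuousOn f (Ioi t₀) := hf.mono Ioi_subset_Ici_self
  refine intervalIntegral.integral_hasDerivAt_right ?_ ?_ (hf'.continuousAt (Ioi_mem_nhds ht))
  · exact intervalIntegrable_of_Icc ht.le (hf.mono Icc_subset_Ici_self)
  · exact hf'.stronglyMeasurableAtFilter isOpen_Ioi t ht

theorem continuousOn_primitive {f : ℝ → ℝ} {t₀ : ℝ} (hf : ContinuousOn f (Ici t₀)) :
    ContinuousOn (fun s => ∫ r in t₀..s, f r) (Ici t₀) := by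
  have h1 : Continuous fun r => f (max t₀ r) :=
    hf.comp_continuous (by fun_prop) fun r => le_max_left t₀ r
  have h2 : Continuous fun s => ∫ r in t₀..s, f (max t₀ r) :=
    intervalIntegral.continuous_primitive (fun _ _ => h1.intervalIntegrable _ _) t₀
  refine h2.continuousOn.congr fun s hs => intervalIntegral.integral_congr fun r hr => ?_
  rw [uIcc_of_le hs] at hr
  simp [max_eq_right hr.1]

theorem exists_pos_rpow_le {p a b : ℝ} (hp : 0 < p) (ha : 0 < a) (hb : 0 < b) :
    ∃ s : ℝ, 0 < s ∧ s ≤ a ∧ s ^ p ≤ b := by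
  refine ⟨min a (b ^ p⁻¹), lt_min ha (Real.rpow_pos_of_pos hb _), min_le_left _ _, ?_⟩
  have h := Real.rpow_le_rpow (le_min ha.le (Real.rpow_nonneg hb.le _))
    (min_le_right a (b ^ p⁻¹)) hp.le
  rwa [Real.rpow_inv_rpow hb.le hp.ne'] at h

theorem exists_pos_sq_lt {σ N S : ℝ} (hσ : 0 < σ) (hN : 0 < N) (hS : 0 < S) :
    ∃ δ : ℝ, 0 < δ ∧ ∀ d, 0 ≤ d → d < δ → d < σ ∧ N * d ^ 2 < S := by
  refine ⟨min σ (Real.sqrt (S / N)), lt_min hσ (Real.sqrt_pos.2 (by positivity)),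
    fun d hd hlt => ⟨hlt.trans_le (min_le_left _ _), ?_⟩⟩
  have h1 := (Real.lt_sqrt hd).1 (hlt.trans_le (min_le_right _ _))
  rwa [lt_div_iff₀ hN, mul_comm] at h1

/-! ### Regularity of the coefficients and of classical solutions -/

theorem hasDerivAt_ddt {f : ℝ → ℝ} {t : ℝ} (hf : DifferentiableOn ℝ f (Ici 0)) (ht : 0 < t) :
    HasDerivAt f (ddt f t) t :=
  (hf t ht.le).hasDerivWithinAt.hasDerivAt (Ici_mem_nhds ht)

namespace Problem

variable {P : Problem} {c : Constants}

namespace Assumptions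

theorem differentiableOn_ε (hP : P.Assumptions c) : DifferentiableOn ℝ P.ε (Ici 0) :=
  hP.ε_smooth.differentiableOn (by norm_num)

theorem contDiffOn_ddt_ε (hP : P.Assumptions c) : ContDiffOn ℝ 1 (ddt P.ε) (Ici 0) :=
  hP.ε_smooth.derivWithin (uniqueDiffOn_Ici 0) (by norm_num)

theorem differentiableOn_ddt_ε (hP : P.Assumptions c) : DifferentiableOn ℝ (ddt P.ε) (Ici 0) :=
  hP.contDiffOn_ddt_ε.differentiableOn (by norm_num)

theorem differentiableOn_C (hP : P.Assumptions c) : DifferentiableOn ℝ P.C (Ici 0) :=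
  hP.C_smooth.differentiableOn (by norm_num)

end Assumptions

namespace IsSolution

variable {t₀ t : ℝ} {u : ℝ → ℝ → ℝ}

theorem hasContDeriv (hu : P.IsSolution t₀ u) (ht : t₀ ≤ t) :
    HasContDeriv (fun x => u x t) (fun x => Dx u x t) 0 Real.pi where
  cont := hu.cont.comp (f := fun x : ℝ => (x, t)) (by fun_prop) fun _ hx => ⟨hx, ht⟩
  cont_deriv := hu.cont_x.comp (f := fun x : ℝ => (x, t)) (by fun_prop) fun _ hx => ⟨hx, ht⟩
  deriv x hx := (hu.diff_x t ht x (Ioo_subset_Icc_self hx)).hasDerivWithinAt.hasDerivAt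
    (Icc_mem_nhds hx.1 hx.2)

theorem hasContDeriv_Dx (hu : P.IsSolution t₀ u) (ht : t₀ ≤ t) :
    HasContDeriv (fun x => Dx u x t) (fun x => Dx (Dx u) x t) 0 Real.pi where
  cont := hu.cont_x.comp (f := fun x : ℝ => (x, t)) (by fun_prop) fun _ hx => ⟨hx, ht⟩
  cont_deriv := hu.cont_xx.comp (f := fun x : ℝ => (x, t)) (by fun_prop) fun _ hx => ⟨hx, ht⟩
  deriv x hx := (hu.diff_xx t ht x (Ioo_subset_Icc_self hx)).hasDerivWithinAt.hasDerivAt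
    (Icc_mem_nhds hx.1 hx.2)

theorem continuousOn_Dt (hu : P.IsSolution t₀ u) (ht : t₀ ≤ t) :
    ContinuousOn (fun x => Dt t₀ u x t) (Icc 0 Real.pi) :=
  hu.cont_t.comp (f := fun x : ℝ => (x, t)) (by fun_prop) fun _ hx => ⟨hx, ht⟩

theorem hasContDeriv_Dt (hu : P.IsSolution t₀ u) (ht : t₀ < t) :
    HasContDeriv (fun x => Dt t₀ u x t) (fun x => Dx (Dt t₀ u) x t) 0 Real.pi where
  cont := hu.continuousOn_Dt ht.le
  cont_deriv := hu.cont_xt.comp (f := fun x : ℝ => (x, t)) (by fun_prop) fun _ hx => ⟨hx, ht⟩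
  deriv x hx := (hu.diff_xt t ht x (Ioo_subset_Icc_self hx)).hasDerivWithinAt.hasDerivAt
    (Icc_mem_nhds hx.1 hx.2)

theorem hasDerivAt_time (hu : P.IsSolution t₀ u) {x : ℝ} (hx : x ∈ Icc 0 Real.pi) (ht : t₀ < t) :
    HasDerivAt (u x) (Dt t₀ u x t) t :=
  (hu.diff_t x hx t ht.le).hasDerivWithinAt.hasDerivAt (Ici_mem_nhds ht)

theorem hasDerivAt_Dt (hu : P.IsSolution t₀ u) {x : ℝ} (hx : x ∈ Icc 0 Real.pi) (ht : t₀ < t) :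
    HasDerivAt (Dt t₀ u x) (Dt t₀ (Dt t₀ u) x t) t := by
  have h := (hu.diff_tt x hx).differentiableAt (Ioi_mem_nhds ht)
  have h2 : Dt t₀ (Dt t₀ u) x t = deriv (Dt t₀ u x) t :=
    derivWithin_of_mem_nhds (Ici_mem_nhds ht)
  rw [h2]
  exact h.hasDerivAt

theorem Dt_eq_zero (hu : P.IsSolution t₀ u) (ht : t₀ ≤ t) :
    Dt t₀ u 0 t = 0 ∧ Dt t₀ u Real.pi t = 0 := by
  constructor
  · have h : EqOn (u 0) (fun _ => 0) (Ici t₀) := fun s hs => (hu.boundary s hs).1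
    unfold Dt
    rw [derivWithin_congr h (h ht)]
    simp
  · have h : EqOn (u Real.pi) (fun _ => 0) (Ici t₀) := fun s hs => (hu.boundary s hs).2
    unfold Dt
    rw [derivWithin_congr h (h ht)]
    simp

/-- The mixed derivatives of order two agree: `∂ₜ uₓ = ∂ₓ uₜ`. This follows by differentiating
`u(x, t) - u(x, t₁) = ∫ uₜ ds` under the integral sign. -/
theorem hasDerivAt_Dx (hu : P.IsSolution t₀ u) {x : ℝ} (hx : x ∈ Ioo 0 Real.pi) (ht : t₀ < t) :
    HasDerivAt (Dx u x) (Dx (Dt t₀ u) x t) t := by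
  set t₁ := (t₀ + t) / 2 with ht₁
  have h01 : t₀ < t₁ := by rw [ht₁]; linarith
  have h1t : t₁ < t := by rw [ht₁]; linarith
  have hxI := Ioo_subset_Icc_self hx
  have key : ∀ s, t₁ ≤ s → Dx u x s = Dx u x t₁ + ∫ r in t₁..s, Dx (Dt t₀ u) x r := by
    intro s hs
    have h1 : HasDerivAt (fun y => ∫ r in t₁..s, Dt t₀ u y r) (∫ r in t₁..s, Dx (Dt t₀ u) x r) x := by
      refine hasDerivAt_integral_param (f := fun r y => Dt t₀ u y r)
        (f' := fun r y => Dx (Dt t₀ u) y r) hs isOpen_Ioo hx (fun y hy => ?_) ?_ ?_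
      · exact hu.cont_t.comp (f := fun r : ℝ => (y, r)) (by fun_prop)
          fun r hr => ⟨Ioo_subset_Icc_self hy, h01.le.trans hr.1⟩
      · exact hu.cont_xt.comp (f := fun p : ℝ × ℝ => (p.2, p.1)) (by fun_prop)
          fun p hp => ⟨Ioo_subset_Icc_self hp.2, h01.trans_le hp.1.1⟩
      · intro r hr y hy
        exact (hu.hasContDeriv_Dt (h01.trans hr.1)).deriv y hy
    have h2 : HasDerivAt (fun y => u y s - u y t₁) (Dx u x s - Dx u x t₁) x :=
      ((hu.hasContDeriv (h01.le.trans hs)).deriv x hx).sub ((hu.hasContDeriv h01.le).deriv x hx)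
    have h3 : (fun y => ∫ r in t₁..s, Dt t₀ u y r) =ᶠ[𝓝 x] fun y => u y s - u y t₁ := by
      filter_upwards [Icc_mem_nhds hx.1 hx.2] with y hy
      refine intervalIntegral.integral_eq_sub_of_hasDerivAt_of_le hs ?_ ?_ ?_
      · exact hu.cont.comp (f := fun r : ℝ => (y, r)) (by fun_prop)
          fun r hr => ⟨hy, h01.le.trans hr.1⟩
      · exact fun r hr => hu.hasDerivAt_time hy (h01.trans hr.1)
      · refine intervalIntegrable_of_Icc hs ?_
        exact hu.cont_t.comp (f := fun r : ℝ => (y, r)) (by fun_prop)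
          fun r hr => ⟨hy, h01.le.trans hr.1⟩
    have h4 := (h1.congr_of_eventuallyEq h3.symm).unique h2
    linarith
  have hc : ContinuousOn (fun r => Dx (Dt t₀ u) x r) (Ioi t₀) :=
    hu.cont_xt.comp (f := fun r : ℝ => (x, r)) (by fun_prop) fun r hr => ⟨hxI, hr⟩
  have h5 : HasDerivAt (fun s => ∫ r in t₁..s, Dx (Dt t₀ u) x r) (Dx (Dt t₀ u) x t) t := by
    refine intervalIntegral.integral_hasDerivAt_right ?_ ?_ (hc.continuousAt (Ioi_mem_nhds ht))
    · exact intervalIntegrable_of_Icc h1t.le (hc.mono fun r hr => h01.trans_le hr.1)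
    · exact hc.stronglyMeasurableAtFilter isOpen_Ioi t ht
  refine (h5.const_add (Dx u x t₁)).congr_of_eventuallyEq ?_
  filter_upwards [Ici_mem_nhds h1t] with s hs
  exact key s hs

/-- The function `ε u_xx` has a time derivative also where `ε` vanishes and `u_xxt` need not
exist. -/
theorem hasDerivAt_ε_mul (hP : P.Assumptions c) (hu : P.IsSolution t₀ u) (ht₀ : 0 ≤ t₀) {x : ℝ}
    (hx : x ∈ Icc 0 Real.pi) (ht : t₀ < t) :
    HasDerivAt (fun s => P.ε s * Dx (Dx u) x s)
      (ddt P.ε t * Dx (Dx u) x t + P.ε t * Dt t₀ (Dx (Dx u)) x t) t := by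
  have hε := hasDerivAt_ddt hP.differentiableOn_ε (ht₀.trans_lt ht)
  by_cases h : P.ε t = 0
  · have hmin : IsLocalMin P.ε t := by
      filter_upwards [Ioi_mem_nhds (ht₀.trans_lt ht)] with s hs
      rw [h]
      exact hP.ε_nonneg s (mem_Ici.2 (le_of_lt hs))
    have hc : ContinuousAt (Dx (Dx u) x) t :=
      (hu.cont_xx.comp (f := fun r : ℝ => (x, r)) (t := Icc 0 Real.pi ×ˢ Ici t₀) (s := Ici t₀)
        (by fun_prop) fun r hr => ⟨hx, hr⟩).continuousAt (Ici_mem_nhds ht)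
    obtain ⟨h1, h2⟩ := hasDerivAt_mul_of_isLocalMin hε hmin h hc
    rw [h1, h]
    simpa using h2
  · have h1 := (hu.diff_xxt x hx t ht h).hasDerivAt
    have h2 : Dt t₀ (Dx (Dx u)) x t = deriv (Dx (Dx u) x) t :=
      derivWithin_of_mem_nhds (Ici_mem_nhds ht)
    rw [h2]
    exact hε.mul h1

/-- The weak form of `u_xxt = ∂ₓₓ uₜ`, for test functions vanishing at both ends. -/
theorem integral_mul_ε_Dt (hP : P.Assumptions c) (hu : P.IsSolution t₀ u) (ht₀ : 0 ≤ t₀)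
    (ht : t₀ < t) {f f' : ℝ → ℝ} (hf : HasContDeriv f f' 0 Real.pi) (h0 : f 0 = 0)
    (hπ : f Real.pi = 0) :
    ∫ x in (0 : ℝ)..Real.pi, f x * (P.ε t * Dt t₀ (Dx (Dx u)) x t) =
      -(P.ε t * ∫ x in (0 : ℝ)..Real.pi, f' x * Dx (Dt t₀ u) x t) := by
  by_cases h : P.ε t = 0
  · simp [h]
  have hεc : ContinuousOn P.ε (Ioi t₀) :=
    hP.differentiableOn_ε.continuousOn.mono fun s hs => ht₀.trans (le_of_lt hs)
  set S : Set ℝ := Ioi t₀ ∩ P.ε ⁻¹' {0}ᶜ with hSdef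
  have hS : IsOpen S := hεc.isOpen_inter_preimage isOpen_Ioi isOpen_compl_singleton
  have htS : t ∈ S := ⟨ht, h⟩
  have hw : ContinuousOn (fun p : ℝ × ℝ => Dt t₀ (Dx (Dx u)) p.1 p.2) (Icc 0 Real.pi ×ˢ S) := by
    have h1 : ContinuousOn (fun p : ℝ × ℝ => P.ε p.2) (Icc 0 Real.pi ×ˢ S) :=
      hεc.comp (f := fun p : ℝ × ℝ => p.2) (by fun_prop) fun p hp => hp.2.1
    have h2 := (hu.cont_xxt.mono (prod_mono_right (inter_subset_left (s := Ioi t₀)))).div h1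
      (fun p hp => hp.2.2)
    refine h2.congr fun p hp => ?_
    have : P.ε p.2 ≠ 0 := hp.2.2
    simp only [Pi.div_apply]
    field_simp
  have hfc : ContinuousOn (fun p : ℝ × ℝ => f p.1) (Icc 0 Real.pi ×ˢ S) :=
    hf.cont.comp (f := fun p : ℝ × ℝ => p.1) (by fun_prop) fun p hp => hp.1
  have hfc' : ContinuousOn (fun p : ℝ × ℝ => f' p.1) (Icc 0 Real.pi ×ˢ S) :=
    hf.cont_deriv.comp (f := fun p : ℝ × ℝ => p.1) (by fun_prop) fun p hp => hp.1
  have d1 : HasDerivAt (fun s => ∫ x in (0 : ℝ)..Real.pi, f x * Dx (Dx u) x s)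
      (∫ x in (0 : ℝ)..Real.pi, f x * Dt t₀ (Dx (Dx u)) x t) t := by
    refine hasDerivAt_integral_param (f := fun x s => f x * Dx (Dx u) x s)
      (f' := fun x s => f x * Dt t₀ (Dx (Dx u)) x s) Real.pi_pos.le hS htS (fun s hs => ?_)
      (hfc.mul hw) fun x hx s hs => ?_
    · exact hf.cont.mul (hu.hasContDeriv_Dx (le_of_lt hs.1)).cont_deriv
    · have h2 : Dt t₀ (Dx (Dx u)) x s = deriv (Dx (Dx u) x) s :=
        derivWithin_of_mem_nhds (Ici_mem_nhds hs.1)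
      rw [h2]
      exact (hu.diff_xxt x (Ioo_subset_Icc_self hx) s hs.1 hs.2).hasDerivAt.const_mul (f x)
  have d2 : HasDerivAt (fun s => ∫ x in (0 : ℝ)..Real.pi, f' x * Dx u x s)
      (∫ x in (0 : ℝ)..Real.pi, f' x * Dx (Dt t₀ u) x t) t := by
    refine hasDerivAt_integral_param (f := fun x s => f' x * Dx u x s)
      (f' := fun x s => f' x * Dx (Dt t₀ u) x s) Real.pi_pos.le hS htS (fun s hs => ?_)
      (hfc'.mul (hu.cont_xt.mono (prod_mono_right inter_subset_left))) fun x hx s hs => ?_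
    · exact hf.cont_deriv.mul (hu.hasContDeriv (le_of_lt hs.1)).cont_deriv
    · exact (hu.hasDerivAt_Dx hx hs.1).const_mul (f' x)
  have h3 : (fun s => ∫ x in (0 : ℝ)..Real.pi, f x * Dx (Dx u) x s) =ᶠ[𝓝 t]
      fun s => -∫ x in (0 : ℝ)..Real.pi, f' x * Dx u x s := by
    filter_upwards [Ioi_mem_nhds ht] with s hs
    exact hf.integral_mul_deriv (hu.hasContDeriv_Dx (le_of_lt hs)) Real.pi_pos.le h0 hπ
  have h4 := (d1.congr_of_eventuallyEq h3.symm).unique d2.neg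
  have h5 : ∫ x in (0 : ℝ)..Real.pi, f x * (P.ε t * Dt t₀ (Dx (Dx u)) x t) =
      P.ε t * ∫ x in (0 : ℝ)..Real.pi, f x * Dt t₀ (Dx (Dx u)) x t := by
    rw [← intervalIntegral.integral_const_mul]
    congr 1
    ext x
    ring
  rw [h5, h4]
  ring

end IsSolution

/-! ### The Liapunov functional and its derivative along solutions -/

/-- The Liapunov functional, evaluated at `φ = u(·, t)` and `ψ = u_t(·, t)`. Besides the square of
`ε φ_xx - ψ` it contains the weight `γ` of the kinetic energy and the weight `θ` of the cross term
`φ ψ`; the remaining coefficients are those for which the terms `u_x u_xt`, `u u_t` and `F(u) u_t`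
cancel in the derivative along a solution. -/
def liapunov (P : Problem) (θ γ : ℝ) (φ ψ : ℝ → ℝ) (t : ℝ) : ℝ :=
  (∫ x in (0 : ℝ)..Real.pi, (P.ε t * ddx (ddx φ) x - ψ x) ^ 2) / 2
    + γ / 2 * (∫ x in (0 : ℝ)..Real.pi, ψ x ^ 2)
    + θ * (∫ x in (0 : ℝ)..Real.pi, φ x * ψ x)
    + (P.C t * (1 + γ) - ddt P.ε t + P.ε t * (P.a' + θ)) / 2 *
        (∫ x in (0 : ℝ)..Real.pi, ddx φ x ^ 2)
    + P.a' * θ / 2 * (∫ x in (0 : ℝ)..Real.pi, φ x ^ 2)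
    - (1 + γ) * ∫ x in (0 : ℝ)..Real.pi, ∫ y in (0 : ℝ)..φ x, P.F y

/-- The Liapunov functional along a function `u` given on `[t₀, ∞)`. -/
def energy (P : Problem) (θ γ t₀ : ℝ) (u : ℝ → ℝ → ℝ) (t : ℝ) : ℝ :=
  P.liapunov θ γ (fun x => u x t) (fun x => Dt t₀ u x t) t

/-- The nonlinear damping `a u_t` expressed through the other terms of the equation. Unlike `a`
itself it is continuous up to the ends of `[0, π]`. -/
def damping (P : Problem) (t₀ : ℝ) (u : ℝ → ℝ → ℝ) (x t : ℝ) : ℝ :=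
  P.F (u x t) + P.C t * Dx (Dx u) x t + P.ε t * Dt t₀ (Dx (Dx u)) x t - Dt t₀ (Dt t₀ u) x t
    - P.a' * Dt t₀ u x t

namespace IsSolution

variable {t₀ t : ℝ} {u : ℝ → ℝ → ℝ}

theorem continuousOn_damping (hP : P.Assumptions c) (hu : P.IsSolution t₀ u) (ht : t₀ < t) :
    ContinuousOn (fun x => P.damping t₀ u x t) (Icc 0 Real.pi) := by
  have h1 := (hu.hasContDeriv ht.le).cont
  have h2 := (hu.hasContDeriv_Dx ht.le).cont_deriv
  have h3 := hu.continuousOn_Dt ht.le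
  have h4 : ContinuousOn (fun x => P.ε t * Dt t₀ (Dx (Dx u)) x t) (Icc 0 Real.pi) :=
    hu.cont_xxt.comp (f := fun x : ℝ => (x, t)) (by fun_prop) fun _ hx => ⟨hx, ht⟩
  have h5 : ContinuousOn (fun x => Dt t₀ (Dt t₀ u) x t) (Icc 0 Real.pi) :=
    hu.cont_tt.comp (f := fun x : ℝ => (x, t)) (by fun_prop) fun _ hx => ⟨hx, ht⟩
  have h6 : ContinuousOn (fun x => P.F (u x t)) (Icc 0 Real.pi) :=
    hP.F_smooth.continuous.comp_continuousOn h1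
  unfold damping
  fun_prop

theorem hasDerivAt_integral_F (hP : P.Assumptions c) (hu : P.IsSolution t₀ u) (ht : t₀ < t) :
    HasDerivAt (fun s => ∫ x in (0 : ℝ)..Real.pi, ∫ y in (0 : ℝ)..u x s, P.F y)
      (∫ x in (0 : ℝ)..Real.pi, P.F (u x t) * Dt t₀ u x t) t := by
  have hF := hP.F_smooth.continuous
  have hΦ : ∀ z, HasDerivAt (fun z => ∫ y in (0 : ℝ)..z, P.F y) (P.F z) z := fun z =>
    intervalIntegral.integral_hasDerivAt_right (hF.intervalIntegrable _ _)
      hF.aestronglyMeasurable.stronglyMeasurableAtFilter hF.continuousAt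
  have hΦc : Continuous (fun z => ∫ y in (0 : ℝ)..z, P.F y) :=
    continuous_iff_continuousAt.2 fun z => (hΦ z).continuousAt
  refine hasDerivAt_integral_param (f := fun x s => ∫ y in (0 : ℝ)..u x s, P.F y)
    (f' := fun x s => P.F (u x s) * Dt t₀ u x s) Real.pi_pos.le isOpen_Ioi
    (S := Ioi t₀) ht (fun s hs => ?_) ?_ fun x hx s hs => ?_
  · exact hΦc.comp_continuousOn (hu.hasContDeriv (le_of_lt hs)).cont
  · have hsub : Icc (0 : ℝ) Real.pi ×ˢ Ioi t₀ ⊆ Icc 0 Real.pi ×ˢ Ici t₀ :=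
      prod_mono_right Ioi_subset_Ici_self
    exact (hF.comp_continuousOn (hu.cont.mono hsub)).mul (hu.cont_t.mono hsub)
  · exact (hΦ _).comp s (hu.hasDerivAt_time (Ioo_subset_Icc_self hx) hs)

theorem hasDerivAt_energy (hP : P.Assumptions c) (hu : P.IsSolution t₀ u) (ht₀ : 0 ≤ t₀)
    (ht : t₀ < t) (θ γ : ℝ) :
    HasDerivAt (P.energy θ γ t₀ u)
      (-(P.ε t * (P.C t - ddt P.ε t)) * (∫ x in (0 : ℝ)..Real.pi, Dx (Dx u) x t ^ 2)
        - (P.a' * (1 + γ) - θ) * (∫ x in (0 : ℝ)..Real.pi, Dt t₀ u x t ^ 2)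
        - γ * P.ε t * (∫ x in (0 : ℝ)..Real.pi, Dx (Dt t₀ u) x t ^ 2)
        - (1 + γ) * (∫ x in (0 : ℝ)..Real.pi, P.damping t₀ u x t * Dt t₀ u x t)
        + P.ε t * (∫ x in (0 : ℝ)..Real.pi, Dx (Dx u) x t * P.damping t₀ u x t)
        - θ * (∫ x in (0 : ℝ)..Real.pi, u x t * P.damping t₀ u x t)
        - (θ * P.C t - ((1 + γ) * ddt P.C t - ddt (ddt P.ε) t + (P.a' + θ) * ddt P.ε t) / 2) *
            (∫ x in (0 : ℝ)..Real.pi, Dx u x t ^ 2)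
        + P.ε t * (∫ x in (0 : ℝ)..Real.pi, deriv P.F (u x t) * Dx u x t ^ 2)
        + θ * (∫ x in (0 : ℝ)..Real.pi, u x t * P.F (u x t))) t := by
  have hπ := Real.pi_pos.le
  have ht0 : 0 < t := ht₀.trans_lt ht
  have hF := hP.F_smooth.continuous
  have hFd : Differentiable ℝ P.F := hP.F_smooth.differentiable (by norm_num)
  have hsub : Icc (0 : ℝ) Real.pi ×ˢ Ioi t₀ ⊆ Icc 0 Real.pi ×ˢ Ici t₀ :=
    prod_mono_right Ioi_subset_Ici_self
  have hε := hasDerivAt_ddt hP.differentiableOn_ε ht0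
  have hε' := hasDerivAt_ddt hP.differentiableOn_ddt_ε ht0
  have hC := hasDerivAt_ddt hP.differentiableOn_C ht0
  have hsnd : MapsTo (fun p : ℝ × ℝ => p.2) (Icc (0 : ℝ) Real.pi ×ˢ Ioi t₀) (Ici 0) :=
    fun p hp => ht₀.trans (le_of_lt hp.2)
  have kε : ContinuousOn (fun p : ℝ × ℝ => P.ε p.2) (Icc 0 Real.pi ×ˢ Ioi t₀) :=
    hP.differentiableOn_ε.continuousOn.comp (by fun_prop) hsnd
  have kε' : ContinuousOn (fun p : ℝ × ℝ => ddt P.ε p.2) (Icc 0 Real.pi ×ˢ Ioi t₀) :=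
    hP.differentiableOn_ddt_ε.continuousOn.comp (by fun_prop) hsnd
  have ku := hu.cont.mono hsub
  have kx := hu.cont_x.mono hsub
  have kxx := hu.cont_xx.mono hsub
  have kt := hu.cont_t.mono hsub
  have kxt := hu.cont_xt
  have ktt := hu.cont_tt
  have kxxt := hu.cont_xxt
  have slice : ∀ {f : ℝ → ℝ → ℝ}, ContinuousOn (fun p : ℝ × ℝ => f p.1 p.2)
      (Icc 0 Real.pi ×ˢ Ioi t₀) → ∀ s, t₀ < s → ContinuousOn (fun x => f x s) (Icc 0 Real.pi) :=
    fun h s hs => h.comp (f := fun x : ℝ => (x, s)) (by fun_prop) fun _ hx => ⟨hx, hs⟩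
  -- the derivatives of the individual integrals
  have d1 : HasDerivAt (fun s => ∫ x in (0 : ℝ)..Real.pi,
        (P.ε s * Dx (Dx u) x s - Dt t₀ u x s) ^ 2)
      (∫ x in (0 : ℝ)..Real.pi, 2 * (P.ε t * Dx (Dx u) x t - Dt t₀ u x t) *
        (ddt P.ε t * Dx (Dx u) x t + P.ε t * Dt t₀ (Dx (Dx u)) x t - Dt t₀ (Dt t₀ u) x t)) t := by
    refine hasDerivAt_integral_param
      (f := fun x s => (P.ε s * Dx (Dx u) x s - Dt t₀ u x s) ^ 2)
      (f' := fun x s => 2 * (P.ε s * Dx (Dx u) x s - Dt t₀ u x s) *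
        (ddt P.ε s * Dx (Dx u) x s + P.ε s * Dt t₀ (Dx (Dx u)) x s - Dt t₀ (Dt t₀ u) x s))
      hπ isOpen_Ioi (S := Ioi t₀) ht
      (slice (f := fun x s => (P.ε s * Dx (Dx u) x s - Dt t₀ u x s) ^ 2) (by fun_prop))
      (by fun_prop) fun x hx s hs => ?_
    have hxI := Ioo_subset_Icc_self hx
    refine (((hu.hasDerivAt_ε_mul hP ht₀ hxI hs).sub (hu.hasDerivAt_Dt hxI hs)).pow 2).congr_deriv ?_
    simp
  have d2 : HasDerivAt (fun s => ∫ x in (0 : ℝ)..Real.pi, Dt t₀ u x s ^ 2)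
      (∫ x in (0 : ℝ)..Real.pi, 2 * Dt t₀ u x t * Dt t₀ (Dt t₀ u) x t) t := by
    refine hasDerivAt_integral_param (f := fun x s => Dt t₀ u x s ^ 2)
      (f' := fun x s => 2 * Dt t₀ u x s * Dt t₀ (Dt t₀ u) x s) hπ isOpen_Ioi (S := Ioi t₀) ht
      (slice (f := fun x s => Dt t₀ u x s ^ 2) (by fun_prop)) (by fun_prop) fun x hx s hs => ?_
    refine ((hu.hasDerivAt_Dt (Ioo_subset_Icc_self hx) hs).pow 2).congr_deriv ?_
    simp
  have d3 : HasDerivAt (fun s => ∫ x in (0 : ℝ)..Real.pi, u x s * Dt t₀ u x s)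
      (∫ x in (0 : ℝ)..Real.pi, (Dt t₀ u x t * Dt t₀ u x t + u x t * Dt t₀ (Dt t₀ u) x t)) t := by
    refine hasDerivAt_integral_param (f := fun x s => u x s * Dt t₀ u x s)
      (f' := fun x s => Dt t₀ u x s * Dt t₀ u x s + u x s * Dt t₀ (Dt t₀ u) x s) hπ isOpen_Ioi
      (S := Ioi t₀) ht
      (slice (f := fun x s => u x s * Dt t₀ u x s) (by fun_prop)) (by fun_prop) fun x hx s hs => ?_
    have hxI := Ioo_subset_Icc_self hx
    exact (hu.hasDerivAt_time hxI hs).mul (hu.hasDerivAt_Dt hxI hs)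
  have d4 : HasDerivAt (fun s => ∫ x in (0 : ℝ)..Real.pi, Dx u x s ^ 2)
      (∫ x in (0 : ℝ)..Real.pi, 2 * Dx u x t * Dx (Dt t₀ u) x t) t := by
    refine hasDerivAt_integral_param (f := fun x s => Dx u x s ^ 2)
      (f' := fun x s => 2 * Dx u x s * Dx (Dt t₀ u) x s) hπ isOpen_Ioi (S := Ioi t₀) ht
      (slice (f := fun x s => Dx u x s ^ 2) (by fun_prop)) (by fun_prop) fun x hx s hs => ?_
    refine ((hu.hasDerivAt_Dx hx hs).pow 2).congr_deriv ?_
    simp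
  have d5 : HasDerivAt (fun s => ∫ x in (0 : ℝ)..Real.pi, u x s ^ 2)
      (∫ x in (0 : ℝ)..Real.pi, 2 * u x t * Dt t₀ u x t) t := by
    refine hasDerivAt_integral_param (f := fun x s => u x s ^ 2)
      (f' := fun x s => 2 * u x s * Dt t₀ u x s) hπ isOpen_Ioi (S := Ioi t₀) ht
      (slice (f := fun x s => u x s ^ 2) (by fun_prop)) (by fun_prop) fun x hx s hs => ?_
    refine ((hu.hasDerivAt_time (Ioo_subset_Icc_self hx) hs).pow 2).congr_deriv ?_
    simp
  have d6 := hu.hasDerivAt_integral_F hP ht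
  have dc : HasDerivAt (fun s => (P.C s * (1 + γ) - ddt P.ε s + P.ε s * (P.a' + θ)) / 2)
      ((ddt P.C t * (1 + γ) - ddt (ddt P.ε) t + ddt P.ε t * (P.a' + θ)) / 2) t :=
    (((hC.mul_const _).sub hε').add (hε.mul_const _)).div_const 2
  have dW := (((((d1.div_const 2).add (d2.const_mul (γ / 2))).add (d3.const_mul θ)).add
    (dc.mul d4)).add (d5.const_mul (P.a' * θ / 2))).sub (d6.const_mul (1 + γ))
  refine HasDerivAt.congr_deriv (f := P.energy θ γ t₀ u) dW ?_
  -- at the fixed time `t`, all derivatives are expressed through `u`, `u_xx`, `u_t`, `ε u_xxt`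
  -- and the damping
  have hu0 := hu.hasContDeriv ht.le
  have hu1 := hu.hasContDeriv_Dx ht.le
  have hv := hu.hasContDeriv_Dt ht
  have hub := hu.boundary t ht.le
  have hvb := hu.Dt_eq_zero ht.le
  have cu := hu0.cont
  have cx := hu0.cont_deriv
  have cxx := hu1.cont_deriv
  have cv := hv.cont
  have cw := slice (f := fun x s => P.ε s * Dt t₀ (Dx (Dx u)) x s) kxxt t ht
  have cq := hu.continuousOn_damping hP ht
  have cF : ContinuousOn (fun x => P.F (u x t)) (Icc 0 Real.pi) := hF.comp_continuousOn cu
  have hFu : HasContDeriv (fun x => P.F (u x t)) (fun x => deriv P.F (u x t) * Dx u x t)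
      0 Real.pi := by
    refine ⟨cF, ?_, fun x hx => ?_⟩
    · exact ((hP.F_smooth.continuous_deriv (by norm_num)).comp_continuousOn cu).mul cx
    · exact (hFd (u x t)).hasDerivAt.comp x (hu0.deriv x hx)
  have cvx := hv.cont_deriv
  have e1 := hu0.integral_mul_deriv hu1 hπ hub.1 hub.2
  have e2 := hv.integral_mul_deriv hu1 hπ hvb.1 hvb.2
  have e3 := hFu.integral_mul_deriv hu1 hπ (by simp [hub.1, hP.F_zero]) (by simp [hub.2, hP.F_zero])
  have e4 := hu.integral_mul_ε_Dt hP ht₀ ht hu0 hub.1 hub.2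
  have e5 := hu.integral_mul_ε_Dt hP ht₀ ht hv hvb.1 hvb.2
  have hvt : ∀ x, Dt t₀ (Dt t₀ u) x t = P.F (u x t) + P.C t * Dx (Dx u) x t
      + P.ε t * Dt t₀ (Dx (Dx u)) x t - P.a' * Dt t₀ u x t - P.damping t₀ u x t := by
    intro x; unfold damping; ring
  have i1 : ∫ x in (0 : ℝ)..Real.pi, 2 * (P.ε t * Dx (Dx u) x t - Dt t₀ u x t) *
        (ddt P.ε t * Dx (Dx u) x t + P.ε t * Dt t₀ (Dx (Dx u)) x t - Dt t₀ (Dt t₀ u) x t)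
      = ∫ x in (0 : ℝ)..Real.pi, ((2 * P.ε t * (ddt P.ε t - P.C t)) * Dx (Dx u) x t ^ 2
        + (2 * P.ε t) * (Dx (Dx u) x t * P.damping t₀ u x t)
        + (2 * P.ε t * P.a' - 2 * (ddt P.ε t - P.C t)) * (Dt t₀ u x t * Dx (Dx u) x t)
        + (-(2 * P.ε t)) * (P.F (u x t) * Dx (Dx u) x t)
        + (-2) * (P.damping t₀ u x t * Dt t₀ u x t)
        + (-(2 * P.a')) * Dt t₀ u x t ^ 2
        + 2 * (P.F (u x t) * Dt t₀ u x t)) := by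
    congr 1; ext x; rw [hvt x]; ring
  have i2 : ∫ x in (0 : ℝ)..Real.pi, 2 * Dt t₀ u x t * Dt t₀ (Dt t₀ u) x t
      = ∫ x in (0 : ℝ)..Real.pi, (2 * (P.F (u x t) * Dt t₀ u x t)
        + (2 * P.C t) * (Dt t₀ u x t * Dx (Dx u) x t)
        + 2 * (Dt t₀ u x t * (P.ε t * Dt t₀ (Dx (Dx u)) x t))
        + (-(2 * P.a')) * Dt t₀ u x t ^ 2
        + (-2) * (P.damping t₀ u x t * Dt t₀ u x t)) := by
    congr 1; ext x; rw [hvt x]; ring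
  have i3 : ∫ x in (0 : ℝ)..Real.pi,
        (Dt t₀ u x t * Dt t₀ u x t + u x t * Dt t₀ (Dt t₀ u) x t)
      = ∫ x in (0 : ℝ)..Real.pi, (Dt t₀ u x t ^ 2 + u x t * P.F (u x t)
        + P.C t * (u x t * Dx (Dx u) x t)
        + u x t * (P.ε t * Dt t₀ (Dx (Dx u)) x t)
        + (-P.a') * (u x t * Dt t₀ u x t)
        + (-1) * (u x t * P.damping t₀ u x t)) := by
    congr 1; ext x; rw [hvt x]; ring
  have i4 : ∫ x in (0 : ℝ)..Real.pi, 2 * Dx u x t * Dx (Dt t₀ u) x t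
      = 2 * ∫ x in (0 : ℝ)..Real.pi, Dx (Dt t₀ u) x t * Dx u x t := by
    rw [← intervalIntegral.integral_const_mul]; congr 1; ext x; ring
  have i5 : ∫ x in (0 : ℝ)..Real.pi, 2 * u x t * Dt t₀ u x t
      = 2 * ∫ x in (0 : ℝ)..Real.pi, u x t * Dt t₀ u x t := by
    rw [← intervalIntegral.integral_const_mul]; congr 1; ext x; ring
  have i6 : ∫ x in (0 : ℝ)..Real.pi, Dx u x t * Dx u x t
      = ∫ x in (0 : ℝ)..Real.pi, Dx u x t ^ 2 := by
    congr 1; ext x; ring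
  have i7 : ∫ x in (0 : ℝ)..Real.pi, Dx u x t * Dx (Dt t₀ u) x t
      = ∫ x in (0 : ℝ)..Real.pi, Dx (Dt t₀ u) x t * Dx u x t := by
    congr 1; ext x; ring
  have i8 : ∫ x in (0 : ℝ)..Real.pi, Dx (Dt t₀ u) x t * Dx (Dt t₀ u) x t
      = ∫ x in (0 : ℝ)..Real.pi, Dx (Dt t₀ u) x t ^ 2 := by
    congr 1; ext x; ring
  have i9 : ∫ x in (0 : ℝ)..Real.pi, deriv P.F (u x t) * Dx u x t * Dx u x t
      = ∫ x in (0 : ℝ)..Real.pi, deriv P.F (u x t) * Dx u x t ^ 2 := by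
    congr 1; ext x; ring
  rw [i1, i2, i3, i4, i5]
  simp (disch := exact intervalIntegrable_of_Icc hπ (by fun_prop)) only
    [intervalIntegral.integral_add, intervalIntegral.integral_const_mul, e1, e2, e3, e4, e5, i6,
      i7, i8, i9]
  ring

end IsSolution

/-! ### Consequences of the assumptions on the constants -/

theorem abs_deriv_le_m (hF : ContDiff ℝ 1 P.F) {z σ : ℝ} (hz : |z| ≤ σ) :
    |deriv P.F z| ≤ P.m σ := by
  have hc : Continuous fun ζ => |deriv P.F ζ| := (hF.continuous_deriv (by norm_num)).abs
  exact le_csSup (isCompact_Icc.image hc).bddAbove ⟨z, abs_le.1 hz, rfl⟩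

theorem m_nonneg (hF : ContDiff ℝ 1 P.F) {σ : ℝ} (hσ : 0 ≤ σ) : 0 ≤ P.m σ :=
  (abs_nonneg _).trans (abs_deriv_le_m hF (z := 0) (by simpa using hσ))

theorem m_mono (hF : ContDiff ℝ 1 P.F) {σ σ' : ℝ} (hσ : 0 ≤ σ) (h : σ ≤ σ') : P.m σ ≤ P.m σ' := by
  refine csSup_le ((nonempty_Icc.2 (by linarith)).image _) ?_
  rintro _ ⟨z, hz, rfl⟩
  exact abs_deriv_le_m hF ((abs_le.2 hz).trans h)

theorem infPos_le {f : ℝ → ℝ} (hf : BddBelow (f '' Ioi 0)) {t : ℝ} (ht : 0 < t) :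
    infPos f ≤ f t :=
  csInf_le hf ⟨t, ht, rfl⟩

namespace Assumptions

theorem infPos_ε_nonneg (hP : P.Assumptions c) : 0 ≤ infPos P.ε := by
  refine Real.sInf_nonneg ?_
  rintro _ ⟨t, ht, rfl⟩
  exact hP.ε_nonneg t (Ioi_subset_Ici_self ht)

theorem infPos_ε_le (hP : P.Assumptions c) {t : ℝ} (ht : 0 < t) : infPos P.ε ≤ P.ε t := by
  refine infPos_le ⟨0, ?_⟩ ht
  rintro _ ⟨s, hs, rfl⟩
  exact hP.ε_nonneg s (Ioi_subset_Ici_self hs)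

theorem infPos_C_le (hP : P.Assumptions c) {t : ℝ} (ht : 0 < t) : infPos P.C ≤ P.C t := by
  refine infPos_le ⟨0, ?_⟩ ht
  rintro _ ⟨s, hs, rfl⟩
  exact (hP.C_pos s (Ioi_subset_Ici_self hs)).le

theorem infPos_C_pos (hP : P.Assumptions c) : 0 < infPos P.C :=
  hP.k_nonneg.trans_lt hP.C_gt

theorem a'_add_infPos_ε_pos (hP : P.Assumptions c) : 0 < P.a' + infPos P.ε := by
  linarith [hP.a'_bound, hP.infPos_ε_nonneg]

theorem θ_pos (hP : P.Assumptions c) {θ : ℝ} (hθ : P.θ₂ c < θ) : 0 < θ := by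
  have h : (infPos P.C + 5 / 4) / (P.a' + infPos P.ε / 2) < θ := (le_max_right _ _).trans_lt hθ
  have := hP.infPos_C_pos
  have := hP.a'_bound
  exact lt_trans (by positivity) h

theorem two_mul_a'_lt {θ : ℝ} (hθ : P.θ₂ c < θ) : 2 * P.a' < θ :=
  ((le_max_left _ _).trans (le_max_left _ _)).trans_lt hθ

theorem two_mul_k_lt (hP : P.Assumptions c) {θ : ℝ} (hθ : P.θ₂ c < θ) :
    2 * c.k < c.μ * (P.a' + θ) := by
  have h : 2 * c.k / c.μ - P.a' < θ :=
    (((le_max_left _ _).trans (le_max_right _ _)).trans (le_max_left _ _)).trans_lt hθ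
  have h1 : 2 * c.k / c.μ < P.a' + θ := by linarith
  rw [div_lt_iff₀ hP.μ_pos] at h1
  linarith

theorem a'_add_θ_pos (hP : P.Assumptions c) {θ : ℝ} (hθ : P.θ₂ c < θ) : 0 < P.a' + θ := by
  have h := hP.two_mul_k_lt hθ
  have h1 : 0 < c.μ * (P.a' + θ) := by linarith [hP.k_nonneg]
  exact pos_of_mul_pos_right h1 hP.μ_pos.le

theorem five_lt (hP : P.Assumptions c) {θ : ℝ} (hθ : P.θ₂ c < θ) :
    5 < infPos (ddt (ddt P.ε)) + P.a' * (c.μ - infPos P.C) +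
      θ * (c.μ + infPos P.C / 2 - 2 * c.k) := by
  have h : (5 - infPos (ddt (ddt P.ε)) - P.a' * (c.μ - infPos P.C)) /
      (c.μ + infPos P.C / 2 - 2 * c.k) < θ :=
    (((le_max_right _ _).trans (le_max_right _ _)).trans (le_max_left _ _)).trans_lt hθ
  rw [div_lt_iff₀ hP.gap] at h
  linarith

theorem γ₃₁_sub_eq (P : Problem) (c : Constants) (θ : ℝ) :
    P.γ₃₁ c θ - (1 + θ) / (P.a' + infPos P.ε) =
      θ * (P.a' + θ) + θ + 2 + (P.a' + θ) / c.μ := by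
  unfold γ₃₁; ring

theorem γ₃₂_nonneg (hP : P.Assumptions c) {θ : ℝ} (hθ : P.θ₂ c < θ) : 0 ≤ P.γ₃₂ c θ := by
  have := hP.a'_add_infPos_ε_pos
  have := hP.μ_pos
  have := hP.infPos_C_pos
  have := hP.θ_pos hθ
  unfold γ₃₂; positivity

theorem γ₃₁_le (hP : P.Assumptions c) {θ σ : ℝ} (hθ : P.θ₂ c < θ) (hσ : 0 ≤ σ) :
    P.γ₃₁ c θ ≤ P.γ₃ c θ σ := by
  have := mul_nonneg (hP.γ₃₂_nonneg hθ) (Real.rpow_nonneg hσ (2 * c.τ))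
  unfold γ₃; linarith

theorem γ₃_mono (hP : P.Assumptions c) {θ σ σ' : ℝ} (hθ : P.θ₂ c < θ) (hσ : 0 ≤ σ)
    (h : σ ≤ σ') : P.γ₃ c θ σ ≤ P.γ₃ c θ σ' := by
  have h1 := Real.rpow_le_rpow hσ h (by linarith [hP.τ_pos] : 0 ≤ 2 * c.τ)
  have := mul_le_mul_of_nonneg_left h1 (hP.γ₃₂_nonneg hθ)
  unfold γ₃; linarith

theorem le_γ₃ (hP : P.Assumptions c) {θ σ : ℝ} (hθ : P.θ₂ c < θ) (hσ : 0 ≤ σ) :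
    θ * (P.a' + θ) + θ + 2 + (P.a' + θ) / c.μ ≤ P.γ₃ c θ σ := by
  have h1 := hP.γ₃₁_le hθ hσ
  have h2 := γ₃₁_sub_eq P c θ
  have h3 : 0 ≤ (1 + θ) / (P.a' + infPos P.ε) := by
    have := hP.a'_add_infPos_ε_pos
    have := hP.θ_pos hθ
    positivity
  linarith

theorem θ_add_two_le_γ₃ (hP : P.Assumptions c) {θ σ : ℝ} (hθ : P.θ₂ c < θ) (hσ : 0 ≤ σ) :
    θ + 2 ≤ P.γ₃ c θ σ := by
  have h1 := hP.le_γ₃ hθ hσ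
  have h2 := hP.a'_add_θ_pos hθ
  have h3 := div_pos h2 hP.μ_pos
  nlinarith [hP.θ_pos hθ]

theorem a'_add_θ_le_γ₃ (hP : P.Assumptions c) {θ σ : ℝ} (hθ : P.θ₂ c < θ) (hσ : 0 ≤ σ) :
    P.a' + θ ≤ c.μ * P.γ₃ c θ σ := by
  have h1 := hP.le_γ₃ hθ hσ
  have h2 := hP.a'_add_θ_pos hθ
  have h3 : (P.a' + θ) / c.μ ≤ P.γ₃ c θ σ := by nlinarith [hP.θ_pos hθ]
  rwa [div_le_iff₀ hP.μ_pos, mul_comm] at h3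

theorem θ_sq_le (hP : P.Assumptions c) {θ σ : ℝ} (hθ : P.θ₂ c < θ) (hσ : 0 ≤ σ) :
    θ ^ 2 ≤ P.γ₃ c θ σ * (2 + 2 * P.γ₃ c θ σ - P.a' * θ) := by
  have h1 := hP.le_γ₃ hθ hσ
  have h2 := hP.a'_add_θ_pos hθ
  have h3 := div_pos h2 hP.μ_pos
  have h4 := hP.θ_pos hθ
  have h5 := hP.θ_add_two_le_γ₃ hθ hσ
  set γ := P.γ₃ c θ σ
  -- `γ ≥ θ²` if `a' ≥ -1`, while the last factor is at least `θ` if `a' < -1`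
  by_cases h : -1 ≤ P.a'
  · have h6 : θ ^ 2 ≤ γ := by nlinarith
    have h7 : 1 ≤ 2 + 2 * γ - P.a' * θ := by nlinarith
    nlinarith
  · have h6 : θ ≤ 2 + 2 * γ - P.a' * θ := by nlinarith
    nlinarith

/-- The weight `γ` of the kinetic energy times the effective linear damping `a' + e` dominates the
cross terms and the nonlinear damping. -/
theorem damping_le (hP : P.Assumptions c) {θ σ e : ℝ} (hθ : P.θ₂ c < θ) (hσ : 0 ≤ σ)
    (he : infPos P.ε ≤ e) :
    1 + θ + 2 * (P.a' + e) + c.A ^ 2 * σ ^ (2 * c.τ) * (1 / c.μ + θ / infPos P.C) ≤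
      P.γ₃ c θ σ * (P.a' + e) := by
  have h0 := hP.a'_add_infPos_ε_pos
  have h1 := hP.μ_pos
  have h2 := hP.infPos_C_pos
  have h3 := hP.θ_pos hθ
  have h4 := hP.a'_add_θ_pos hθ
  have h5 := Real.rpow_nonneg hσ (2 * c.τ)
  set s := P.a' + infPos P.ε with hs
  have h6 : P.γ₃ c θ σ = (1 + θ + c.A ^ 2 * σ ^ (2 * c.τ) * (1 / c.μ + θ / infPos P.C)) / s
      + (θ * (P.a' + θ) + θ + 2 + (P.a' + θ) / c.μ) := by
    have := γ₃₁_sub_eq P c θ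
    have h' : P.γ₃₁ c θ = (1 + θ) / s + (θ * (P.a' + θ) + θ + 2 + (P.a' + θ) / c.μ) := by
      linarith
    unfold γ₃ γ₃₂
    rw [h', ← hs]
    ring
  set q := 1 + θ + c.A ^ 2 * σ ^ (2 * c.τ) * (1 / c.μ + θ / infPos P.C) with hq
  have hq0 : 0 ≤ q := by positivity
  have h7 : s ≤ P.a' + e := by linarith
  have h8 : q ≤ q / s * (P.a' + e) := by
    rw [div_mul_eq_mul_div, le_div_iff₀ h0]
    exact mul_le_mul_of_nonneg_left h7 hq0
  have h9 : 0 < (P.a' + θ) / c.μ := div_pos h4 h1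
  have h10 : 2 * (P.a' + e) ≤ (θ * (P.a' + θ) + θ + 2 + (P.a' + θ) / c.μ) * (P.a' + e) := by
    refine mul_le_mul_of_nonneg_right ?_ (by linarith)
    nlinarith
  rw [h6]
  linarith

theorem one_le_g (hP : P.Assumptions c) {t : ℝ} (ht : 0 ≤ t) : 1 ≤ P.g t := by
  have h1 := hP.C_sub t ht
  have h2 := hP.C_pos t ht
  have h3 : 0 ≤ c.μ * (1 + P.ε t) := mul_nonneg hP.μ_pos.le (by linarith [hP.ε_nonneg t ht])
  unfold g; linarith

theorem ε_le_g (hP : P.Assumptions c) {t : ℝ} (ht : 0 ≤ t) : P.ε t ≤ 2 / c.μ * P.g t := by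
  have h1 := hP.C_sub t ht
  have h2 := hP.C_pos t ht
  have h3 := hP.μ_pos
  have h4 : c.μ * P.ε t ≤ 2 * P.g t := by unfold g; linarith
  rw [div_mul_eq_mul_div, le_div_iff₀ h3]
  linarith

end Assumptions

/-! ### Two-sided bounds for the Liapunov functional -/

section Bounds

variable {φ ψ : ℝ → ℝ} {t : ℝ}

theorem d_sq (hφ : HasContDeriv φ (ddx φ) 0 Real.pi)
    (hφ' : HasContDeriv (ddx φ) (ddx (ddx φ)) 0 Real.pi) (hψ : ContinuousOn ψ (Icc 0 Real.pi)) :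
    P.d φ ψ t ^ 2 = P.ε t ^ 2 * (∫ x in (0 : ℝ)..Real.pi, ddx (ddx φ) x ^ 2)
      + (∫ x in (0 : ℝ)..Real.pi, ddx φ x ^ 2) + (∫ x in (0 : ℝ)..Real.pi, φ x ^ 2)
      + ∫ x in (0 : ℝ)..Real.pi, ψ x ^ 2 := by
  have hπ := Real.pi_pos.le
  have c0 := hφ.cont
  have c1 := hφ.cont_deriv
  have c2 := hφ'.cont_deriv
  unfold d
  rw [Real.sq_sqrt (intervalIntegral.integral_nonneg hπ fun x _ => by positivity)]
  simp (disch := exact intervalIntegrable_of_Icc hπ (by fun_prop)) only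
    [intervalIntegral.integral_add, intervalIntegral.integral_const_mul]

theorem integral_sq_nonneg (f : ℝ → ℝ) : 0 ≤ ∫ x in (0 : ℝ)..Real.pi, f x ^ 2 :=
  intervalIntegral.integral_nonneg Real.pi_pos.le fun _ _ => sq_nonneg _

theorem abs_le_d (hφ : HasContDeriv φ (ddx φ) 0 Real.pi)
    (hφ' : HasContDeriv (ddx φ) (ddx (ddx φ)) 0 Real.pi) (hψ : ContinuousOn ψ (Icc 0 Real.pi))
    (h0 : φ 0 = 0) (hπ : φ Real.pi = 0) {x : ℝ} (hx : x ∈ Icc 0 Real.pi) :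
    |φ x| ≤ P.d φ ψ t := by
  refine abs_le_of_sq_le_sq ?_ (Real.sqrt_nonneg _)
  rw [d_sq hφ hφ' hψ]
  have h1 := hφ.sq_le_integral h0 hπ hx
  have h2 := integral_sq_nonneg φ
  have h3 := integral_sq_nonneg ψ
  have h4 := integral_sq_nonneg (ddx (ddx φ))
  have h5 := mul_nonneg (sq_nonneg (P.ε t)) h4
  linarith

theorem continuous_integral_F (hF : ContDiff ℝ 1 P.F) :
    Continuous fun z => ∫ y in (0 : ℝ)..z, P.F y :=
  intervalIntegral.continuous_primitive (fun _ _ => hF.continuous.intervalIntegrable _ _) 0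

theorem liapunov_le (hP : P.Assumptions c) {θ σ : ℝ} (hθ : P.θ₂ c < θ) (hσ : 0 ≤ σ) (ht : 0 ≤ t)
    (hφ : HasContDeriv φ (ddx φ) 0 Real.pi)
    (hφ' : HasContDeriv (ddx φ) (ddx (ddx φ)) 0 Real.pi) (hψ : ContinuousOn ψ (Icc 0 Real.pi))
    (h0 : φ 0 = 0) (hφπ : φ Real.pi = 0) (hd : P.d φ ψ t ≤ σ) :
    P.liapunov θ (P.γ₃ c θ σ) φ ψ t ≤
      (1 + P.m σ) * (1 + P.γ₃ c θ σ) * P.g t * P.d φ ψ t ^ 2 := by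
  have hπ := Real.pi_pos.le
  have c0 := hφ.cont
  have c1 := hφ.cont_deriv
  have c2 := hφ'.cont_deriv
  have hγ := hP.θ_add_two_le_γ₃ hθ hσ
  have hγμ := hP.a'_add_θ_le_γ₃ hθ hσ
  have hγθ := hP.θ_sq_le hθ hσ
  have hθ0 := hP.θ_pos hθ
  have hm := m_nonneg hP.F_smooth hσ
  have hg := hP.one_le_g ht
  have hε := hP.ε_nonneg t ht
  have hC := hP.C_pos t ht
  have hCε := hP.C_sub t ht
  have hμ := hP.μ_pos
  rw [d_sq hφ hφ' hψ]
  unfold liapunov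
  set γ := P.γ₃ c θ σ
  set X := ∫ x in (0 : ℝ)..Real.pi, ddx (ddx φ) x ^ 2 with hX
  set Y := ∫ x in (0 : ℝ)..Real.pi, ddx φ x ^ 2 with hY
  set U := ∫ x in (0 : ℝ)..Real.pi, φ x ^ 2 with hU
  set V := ∫ x in (0 : ℝ)..Real.pi, ψ x ^ 2 with hV
  have hX0 : 0 ≤ X := integral_sq_nonneg _
  have hY0 : 0 ≤ Y := integral_sq_nonneg _
  have hU0 : 0 ≤ U := integral_sq_nonneg _
  have hV0 : 0 ≤ V := integral_sq_nonneg _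
  have i1 : ∫ x in (0 : ℝ)..Real.pi, (P.ε t * ddx (ddx φ) x - ψ x) ^ 2 ≤
      2 * P.ε t ^ 2 * X + 2 * V := by
    have h : ∫ x in (0 : ℝ)..Real.pi, (P.ε t * ddx (ddx φ) x - ψ x) ^ 2 ≤
        ∫ x in (0 : ℝ)..Real.pi, ((2 * P.ε t ^ 2) * ddx (ddx φ) x ^ 2 + 2 * ψ x ^ 2) :=
      integral_mono_Icc hπ (by fun_prop) (by fun_prop) fun x _ => by
        linarith only [sq_nonneg (P.ε t * ddx (ddx φ) x + ψ x)]
    simpa (disch := exact intervalIntegrable_of_Icc hπ (by fun_prop)) only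
      [intervalIntegral.integral_add, intervalIntegral.integral_const_mul] using h
  have i2 : 2 * θ * (∫ x in (0 : ℝ)..Real.pi, φ x * ψ x) ≤
      γ * V + (2 + 2 * γ - P.a' * θ) * U := by
    have h : ∫ x in (0 : ℝ)..Real.pi, (2 * θ) * (φ x * ψ x) ≤
        ∫ x in (0 : ℝ)..Real.pi, (γ * ψ x ^ 2 + (2 + 2 * γ - P.a' * θ) * φ x ^ 2) := by
      refine integral_mono_Icc hπ (by fun_prop) (by fun_prop) fun x _ => ?_
      have hγ0 : 0 < γ := by linarith
      refine le_of_mul_le_mul_left ?_ hγ0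
      linarith only [sq_nonneg (γ * ψ x - θ * φ x),
        mul_nonneg (sub_nonneg.2 hγθ) (sq_nonneg (φ x))]
    simpa (disch := exact intervalIntegrable_of_Icc hπ (by fun_prop)) only
      [intervalIntegral.integral_add, intervalIntegral.integral_const_mul] using h
  have i3 : -(∫ x in (0 : ℝ)..Real.pi, ∫ y in (0 : ℝ)..φ x, P.F y) ≤ P.m σ / 2 * U := by
    rw [← intervalIntegral.integral_neg, ← intervalIntegral.integral_const_mul]
    have hΦ := (continuous_integral_F hP.F_smooth).comp_continuousOn c0
    refine integral_mono_Icc hπ hΦ.neg (by fun_prop) fun x hx => ?_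
    have h1 := integral_le_of_deriv_le (F := fun z => -P.F z) hP.F_smooth.neg
      (by simp [hP.F_zero]) (K := P.m σ) (s := σ) (fun z hz => by
        rw [deriv.fun_neg]
        exact (neg_le_abs _).trans (abs_deriv_le_m hP.F_smooth hz))
      ((abs_le_d hφ hφ' hψ h0 hφπ (Ioo_subset_Icc_self hx)).trans hd)
    rw [intervalIntegral.integral_neg] at h1
    linarith
  have hcoef : P.C t * (1 + γ) - ddt P.ε t + P.ε t * (P.a' + θ) ≤ 2 * (1 + γ) * P.g t := by
    have h1 : P.ε t * (P.a' + θ) ≤ γ * (P.C t - ddt P.ε t) := by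
      have : P.ε t * (P.a' + θ) ≤ P.ε t * (c.μ * γ) := mul_le_mul_of_nonneg_left hγμ hε
      have h2 : c.μ * P.ε t ≤ P.C t - ddt P.ε t := by linarith
      have h3 := mul_le_mul_of_nonneg_left h2 (by linarith : 0 ≤ γ)
      linarith only [this, h3]
    unfold g
    have h4 : 0 ≤ γ * P.C t := mul_nonneg (by linarith) hC.le
    have h5 : 0 ≤ c.μ * (1 + P.ε t) := mul_nonneg hμ.le (by linarith only [hε])
    linarith only [h1, h4, h5, hCε, hC, hγ, hθ0]
  set k := (1 + P.m σ) * (1 + γ) * P.g t with hk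
  have k1 : (1 + γ) * P.g t ≤ k := by
    have : 0 ≤ P.m σ * ((1 + γ) * P.g t) := mul_nonneg hm (mul_nonneg (by linarith) (by linarith))
    rw [hk]; linarith only [this]
  have k2 : (1 + P.m σ) * (1 + γ) ≤ k := by
    have : 0 ≤ (1 + P.m σ) * (1 + γ) := mul_nonneg (by linarith) (by linarith)
    exact le_mul_of_one_le_right this hg
  have k3 : 1 + γ ≤ k := by
    have := mul_nonneg hm (by linarith : 0 ≤ 1 + γ)
    linarith only [this, k2]
  have j1 : (P.C t * (1 + γ) - ddt P.ε t + P.ε t * (P.a' + θ)) / 2 * Y ≤ k * Y :=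
    mul_le_mul_of_nonneg_right (by linarith) hY0
  have j2 : (1 + γ) * -(∫ x in (0 : ℝ)..Real.pi, ∫ y in (0 : ℝ)..φ x, P.F y) ≤
      (1 + γ) * (P.m σ / 2 * U) := mul_le_mul_of_nonneg_left i3 (by linarith)
  have j3 : (1 + γ) * U + (1 + γ) * (P.m σ / 2 * U) ≤ k * U := by
    have := mul_le_mul_of_nonneg_right k2 hU0
    have h' := mul_nonneg (mul_nonneg hm hU0) (by linarith : 0 ≤ 1 + γ)
    linarith only [this, h']
  have j4 : (1 + γ) * V ≤ k * V := mul_le_mul_of_nonneg_right k3 hV0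
  have j5 : P.ε t ^ 2 * X ≤ k * (P.ε t ^ 2 * X) := by
    exact le_mul_of_one_le_left (mul_nonneg (sq_nonneg (P.ε t)) hX0) (by linarith)
  linarith only [i1, i2, j1, j2, j3, j4, j5]

/-- The constant in the lower bound of the Liapunov functional. -/
def lower (P : Problem) (θ : ℝ) : ℝ :=
  1 / (2 * (3 + 8 * (θ ^ 2 + |P.a'| * θ + 1) / infPos P.C))

theorem lower_pos (hP : P.Assumptions c) {θ : ℝ} (hθ : P.θ₂ c < θ) : 0 < P.lower θ := by
  have := hP.infPos_C_pos
  have := hP.θ_pos hθ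
  unfold lower; positivity

/-- The lower bound of the Liapunov functional. The quadratic form
`(ε φ_xx - ψ)² + (γ - 1) ψ² + 2 θ φ ψ + ε (a' + θ) φ_x² + a' θ φ²` is nonnegative in the mean:
after completing the square in `ψ`, Wirtinger's inequality reduces it to
`(ε + θ) (γ (ε + a') - (ε + θ)) ≥ 0`. -/
theorem lower_mul_le_liapunov (hP : P.Assumptions c) {θ σ k' : ℝ} (hθ : P.θ₂ c < θ) (hσ : 0 ≤ σ)
    (ht : 0 < t) (hφ : HasContDeriv φ (ddx φ) 0 Real.pi)
    (hφ' : HasContDeriv (ddx φ) (ddx (ddx φ)) 0 Real.pi) (hψ : ContinuousOn ψ (Icc 0 Real.pi))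
    (h0 : φ 0 = 0) (hφπ : φ Real.pi = 0)
    (hF : ∀ z, |z| ≤ P.d φ ψ t → deriv P.F z ≤ k') (hk0 : 0 ≤ k')
    (hk : (1 + P.γ₃ c θ σ) * (k' - c.k) ≤ infPos P.C / 4) :
    P.lower θ * P.d φ ψ t ^ 2 ≤ P.liapunov θ (P.γ₃ c θ σ) φ ψ t := by
  have hπ := Real.pi_pos.le
  have c0 := hφ.cont
  have c1 := hφ.cont_deriv
  have c2 := hφ'.cont_deriv
  have hγ := hP.θ_add_two_le_γ₃ hθ hσ
  have hθ0 := hP.θ_pos hθ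
  have hε := hP.ε_nonneg t ht.le
  have hε0 := hP.infPos_ε_le ht
  have hC0 := hP.infPos_C_pos
  have hC := hP.infPos_C_le ht
  have hCk := hP.C_gt
  have hCε := hP.C_sub t ht.le
  have hμ := hP.μ_pos
  have hgap := hP.gap
  have ha := hP.a'_bound
  have haθ := hP.a'_add_θ_pos hθ
  have hdamp : 1 + θ + 2 * (P.a' + P.ε t) ≤ P.γ₃ c θ σ * (P.a' + P.ε t) := by
    have h := hP.damping_le hθ hσ hε0
    have : 0 ≤ c.A ^ 2 * σ ^ (2 * c.τ) * (1 / c.μ + θ / infPos P.C) := by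
      have := Real.rpow_nonneg hσ (2 * c.τ)
      positivity
    linarith
  have i3 : (∫ x in (0 : ℝ)..Real.pi, ∫ y in (0 : ℝ)..φ x, P.F y) ≤
      k' / 2 * ∫ x in (0 : ℝ)..Real.pi, φ x ^ 2 := by
    rw [← intervalIntegral.integral_const_mul]
    have hΦ := (continuous_integral_F hP.F_smooth).comp_continuousOn c0
    refine integral_mono_Icc hπ hΦ (by fun_prop) fun x hx => ?_
    have h1 := integral_le_of_deriv_le hP.F_smooth hP.F_zero hF
      (abs_le_d hφ hφ' hψ h0 hφπ (Ioo_subset_Icc_self hx))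
    linarith
  rw [d_sq hφ hφ' hψ]
  unfold liapunov
  have hXY := hφ.integral_deriv_sq_le hφ' h0 hφπ
  have hYU := hφ.integral_sq_le h0 hφπ
  have hS := hφ.integral_mul_deriv hφ' hπ h0 hφπ
  have hS' : ∫ x in (0 : ℝ)..Real.pi, ddx φ x * ddx φ x
      = ∫ x in (0 : ℝ)..Real.pi, ddx φ x ^ 2 := by simp only [sq]
  rw [hS'] at hS
  set γ := P.γ₃ c θ σ
  set X := ∫ x in (0 : ℝ)..Real.pi, ddx (ddx φ) x ^ 2 with hX
  set Y := ∫ x in (0 : ℝ)..Real.pi, ddx φ x ^ 2 with hY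
  set U := ∫ x in (0 : ℝ)..Real.pi, φ x ^ 2 with hU
  set V := ∫ x in (0 : ℝ)..Real.pi, ψ x ^ 2 with hV
  set S := ∫ x in (0 : ℝ)..Real.pi, φ x * ψ x with hSdef
  set Z := ∫ x in (0 : ℝ)..Real.pi, (P.ε t * ddx (ddx φ) x - ψ x) ^ 2 with hZ
  set e := P.ε t
  have hY0 : 0 ≤ Y := integral_sq_nonneg _
  have hU0 : 0 ≤ U := integral_sq_nonneg _
  have hV0 : 0 ≤ V := integral_sq_nonneg _
  -- completing the square in `ψ`
  have i1 : (γ - 1) * e ^ 2 * X - θ ^ 2 * U - 2 * θ * e * Y ≤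
      γ * (Z + (γ - 1) * V + 2 * θ * S) := by
    have h : ∫ x in (0 : ℝ)..Real.pi, (((γ - 1) * e ^ 2) * ddx (ddx φ) x ^ 2
          + (-θ ^ 2) * φ x ^ 2 + (2 * θ * e) * (φ x * ddx (ddx φ) x)) ≤
        ∫ x in (0 : ℝ)..Real.pi, (γ * (e * ddx (ddx φ) x - ψ x) ^ 2
          + (γ * (γ - 1)) * ψ x ^ 2 + (γ * (2 * θ)) * (φ x * ψ x)) := by
      refine integral_mono_Icc hπ (by fun_prop) (by fun_prop) fun x _ => ?_
      linarith only [sq_nonneg (γ * ψ x - (e * ddx (ddx φ) x - θ * φ x))]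
    simp (disch := exact intervalIntegrable_of_Icc hπ (by fun_prop)) only
      [intervalIntegral.integral_add, intervalIntegral.integral_const_mul, hS] at h
    rw [← hX, ← hU, ← hV, ← hSdef, ← hZ] at h
    linarith only [h]
  have i2 : e ^ 2 / 2 * X - θ ^ 2 * U ≤ Z + γ * V + 2 * θ * S := by
    have h : ∫ x in (0 : ℝ)..Real.pi, ((e ^ 2 / 2) * ddx (ddx φ) x ^ 2
          + (-θ ^ 2) * φ x ^ 2) ≤
        ∫ x in (0 : ℝ)..Real.pi, ((e * ddx (ddx φ) x - ψ x) ^ 2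
          + γ * ψ x ^ 2 + (2 * θ) * (φ x * ψ x)) := by
      refine integral_mono_Icc hπ (by fun_prop) (by fun_prop) fun x _ => ?_
      linarith only [sq_nonneg (e * ddx (ddx φ) x - 2 * ψ x), sq_nonneg (ψ x + θ * φ x),
        mul_nonneg (by linarith : 0 ≤ γ - 2) (sq_nonneg (ψ x))]
    simp (disch := exact intervalIntegrable_of_Icc hπ (by fun_prop)) only
      [intervalIntegral.integral_add, intervalIntegral.integral_const_mul] at h
    rw [← hX, ← hU, ← hV, ← hSdef, ← hZ] at h
    linarith only [h]
  set Q := Z + γ * V + 2 * θ * S + e * (P.a' + θ) * Y + P.a' * θ * U with hQ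
  -- after `X ≥ Y` and `Y ≥ U`, the coefficients that have to be nonnegative
  have hβ : 0 ≤ (γ - 1) * e + γ * (P.a' + θ) - 2 * θ := by
    have : 0 ≤ (γ - 2) * θ := mul_nonneg (by linarith only [hγ, hθ0]) hθ0.le
    linarith only [this, hdamp, ha, hε0, hθ0]
  have hsum : 0 ≤ (e + θ) * (γ * (P.a' + e) - (e + θ)) :=
    mul_nonneg (by linarith only [hε, hθ0]) (by linarith only [hdamp, ha, hε0])
  have hQV : V ≤ Q := by
    have h1 : (γ - 1) * e ^ 2 * Y ≤ (γ - 1) * e ^ 2 * X :=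
      mul_le_mul_of_nonneg_left hXY (mul_nonneg (by linarith only [hγ, hθ0]) (sq_nonneg e))
    have h2 : e * ((γ - 1) * e + γ * (P.a' + θ) - 2 * θ) * U ≤
        e * ((γ - 1) * e + γ * (P.a' + θ) - 2 * θ) * Y :=
      mul_le_mul_of_nonneg_left hYU (mul_nonneg hε hβ)
    have h3 := mul_nonneg hsum hU0
    have h4 : 0 ≤ γ * (Q - V) := by rw [hQ]; linarith only [i1, h1, h2, h3]
    have h5 := nonneg_of_mul_nonneg_right h4 (by linarith only [hγ, hθ0] : 0 < γ)
    linarith only [h5]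
  have hQX : e ^ 2 / 2 * X - (θ ^ 2 + |P.a'| * θ) * U ≤ Q := by
    have h1 : 0 ≤ e * (P.a' + θ) * Y := mul_nonneg (mul_nonneg hε haθ.le) hY0
    have h2 : 0 ≤ (P.a' + |P.a'|) * (θ * U) :=
      mul_nonneg (by linarith [neg_abs_le P.a']) (mul_nonneg hθ0.le hU0)
    rw [hQ]; linarith only [i2, h1, h2, neg_abs_le P.a']
  have hT : Q + infPos P.C / 4 * Y ≤ 2 * (Z / 2 + γ / 2 * V + θ * S
      + (P.C t * (1 + γ) - ddt P.ε t + e * (P.a' + θ)) / 2 * Y + P.a' * θ / 2 * U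
      - (1 + γ) * ∫ x in (0 : ℝ)..Real.pi, ∫ y in (0 : ℝ)..φ x, P.F y) := by
    have h1 : (1 + γ) * (∫ x in (0 : ℝ)..Real.pi, ∫ y in (0 : ℝ)..φ x, P.F y) ≤
        (1 + γ) * (k' / 2 * U) := mul_le_mul_of_nonneg_left i3 (by linarith only [hγ, hθ0])
    have h2 : (1 + γ) * k' * U ≤ (1 + γ) * k' * Y :=
      mul_le_mul_of_nonneg_left hYU (mul_nonneg (by linarith only [hγ, hθ0]) hk0)
    have h3 : 2 * (infPos P.C - c.k) ≤ γ * (P.C t - c.k) :=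
      mul_le_mul (by linarith only [hγ, hθ0]) (by linarith only [hC])
        (by linarith only [hCk]) (by linarith only [hγ, hθ0])
    have h4 : 0 ≤ c.μ * e := mul_nonneg hμ.le hε
    have h5 : infPos P.C / 4 ≤ γ * P.C t + (P.C t - ddt P.ε t) - (1 + γ) * k' := by
      linarith only [h3, h4, hk, hCε, hgap, hCk, hC0]
    have h6 := mul_le_mul_of_nonneg_right h5 hY0
    rw [hQ]; linarith only [h1, h2, h6]
  set T := Q + infPos P.C / 4 * Y with hTdef
  have hK0 : 0 ≤ θ ^ 2 + |P.a'| * θ := by positivity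
  set K := θ ^ 2 + |P.a'| * θ
  have hYT : Y ≤ 4 / infPos P.C * T := by
    rw [div_mul_eq_mul_div, le_div_iff₀ hC0]
    linarith only [hTdef, hQV, hV0]
  have hd : e ^ 2 * X + Y + U + V ≤ (3 + 8 * (K + 1) / infPos P.C) * T := by
    have h1 : K * U ≤ K * (4 / infPos P.C * T) := mul_le_mul_of_nonneg_left (hYU.trans hYT) hK0
    have h2 : Q ≤ T := by
      have := mul_nonneg hC0.le hY0
      linarith only [hTdef, this]
    have h3 : (3 + 8 * (K + 1) / infPos P.C) * T = 3 * T + 2 * (K * (4 / infPos P.C * T))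
        + 2 * (4 / infPos P.C * T) := by ring
    rw [h3]
    linarith only [h1, h2, hQX, hQV, hYT, hYU.trans hYT]
  have hpos : 0 < 3 + 8 * (K + 1) / infPos P.C := by positivity
  have hfin : P.lower θ * (e ^ 2 * X + Y + U + V) ≤ T / 2 := by
    have : P.lower θ = 1 / (2 * (3 + 8 * (K + 1) / infPos P.C)) := rfl
    rw [this, one_div_mul_eq_div, div_le_iff₀ (by linarith only [hpos])]
    linarith only [hd]
  linarith only [hfin, hT]

end Bounds

/-! ### Dissipation -/

namespace IsSolution

variable {t₀ t : ℝ} {u : ℝ → ℝ → ℝ}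

theorem dist_sq (hu : P.IsSolution t₀ u) (ht : t₀ ≤ t) :
    P.dist t₀ u t ^ 2 = P.ε t ^ 2 * (∫ x in (0 : ℝ)..Real.pi, Dx (Dx u) x t ^ 2)
      + (∫ x in (0 : ℝ)..Real.pi, Dx u x t ^ 2) + (∫ x in (0 : ℝ)..Real.pi, u x t ^ 2)
      + ∫ x in (0 : ℝ)..Real.pi, Dt t₀ u x t ^ 2 :=
  d_sq (hu.hasContDeriv ht) (hu.hasContDeriv_Dx ht) (hu.continuousOn_Dt ht)

theorem abs_le_dist (hu : P.IsSolution t₀ u) (ht : t₀ ≤ t) {x : ℝ} (hx : x ∈ Icc 0 Real.pi) :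
    |u x t| ≤ P.dist t₀ u t :=
  abs_le_d (φ := fun x => u x t) (hu.hasContDeriv ht) (hu.hasContDeriv_Dx ht)
    (hu.continuousOn_Dt ht) (hu.boundary t ht).1 (hu.boundary t ht).2 hx

theorem damping_bounds (hP : P.Assumptions c) (hu : P.IsSolution t₀ u) (ht₀ : 0 ≤ t₀)
    (ht : t₀ < t) {σ : ℝ} (hd : P.dist t₀ u t ≤ σ) {x : ℝ} (hx : x ∈ Ioo 0 Real.pi) :
    0 ≤ P.damping t₀ u x t * Dt t₀ u x t ∧
      P.damping t₀ u x t ^ 2 ≤ c.A ^ 2 * σ ^ (2 * c.τ) * Dt t₀ u x t ^ 2 := by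
  have hdiff : ContDiffOn ℝ 2 (fun x => u x t) (Icc 0 Real.pi) := by
    have hud := uniqueDiffOn_Icc Real.pi_pos
    rw [show (2 : WithTop ℕ∞) = 1 + 1 by norm_num, contDiffOn_succ_iff_derivWithin hud]
    refine ⟨hu.diff_x t ht.le, by simp, ?_⟩
    rw [show (1 : WithTop ℕ∞) = 0 + 1 by norm_num, contDiffOn_succ_iff_derivWithin hud]
    refine ⟨hu.diff_xx t ht.le, by simp, ?_⟩
    rw [contDiffOn_zero]
    exact (hu.hasContDeriv_Dx ht.le).cont_deriv
  obtain ⟨h1, h2⟩ := hP.a_bound t (ht₀.trans ht.le) (fun x => u x t) (fun x => Dt t₀ u x t) hdiff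
    (hu.continuousOn_Dt ht.le) (hu.boundary t ht.le).1 (hu.boundary t ht.le).2
    (hu.Dt_eq_zero ht.le).1 (hu.Dt_eq_zero ht.le).2 x hx
  have heq := hu.equation x hx t ht
  change 0 ≤ P.a x t (u x t) (Dx u x t) (Dt t₀ u x t) (Dx (Dx u) x t) at h1
  change P.a x t (u x t) (Dx u x t) (Dt t₀ u x t) (Dx (Dx u) x t) ≤
    c.A * P.dist t₀ u t ^ c.τ at h2
  set r := P.a x t (u x t) (Dx u x t) (Dt t₀ u x t) (Dx (Dx u) x t)
  have hq : P.damping t₀ u x t = r * Dt t₀ u x t := by unfold damping; linarith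
  have hd0 : 0 ≤ P.dist t₀ u t := Real.sqrt_nonneg _
  have h3 : r ≤ c.A * σ ^ c.τ := h2.trans
    (mul_le_mul_of_nonneg_left (Real.rpow_le_rpow hd0 hd hP.τ_pos.le) hP.A_nonneg)
  have h4 : r ^ 2 ≤ c.A ^ 2 * σ ^ (2 * c.τ) := by
    have h5 := pow_le_pow_left₀ h1 h3 2
    have h6 : (σ ^ c.τ) ^ 2 = σ ^ (2 * c.τ) := by
      rw [← Real.rpow_natCast, ← Real.rpow_mul (hd0.trans hd)]
      congr 1; push_cast; ring
    rwa [mul_pow, h6] at h5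
  rw [hq]
  constructor
  · have := mul_nonneg h1 (sq_nonneg (Dt t₀ u x t)); linarith
  · rw [mul_pow]; exact mul_le_mul_of_nonneg_right h4 (sq_nonneg _)

/-- The differential inequality for the Liapunov functional. -/
theorem exists_deriv_energy_le (hP : P.Assumptions c) (hu : P.IsSolution t₀ u) (ht₀ : 0 ≤ t₀)
    (ht : t₀ < t) {θ σ k' : ℝ} (hθ : P.θ₂ c < θ) (hσ : 0 ≤ σ) (hd : P.dist t₀ u t ≤ σ)
    (hC : (1 + P.γ₃ c θ σ) * ddt P.C t ≤ 1)
    (hF : ∀ z, |z| ≤ P.dist t₀ u t → deriv P.F z ≤ k') (hk : c.k ≤ k') :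
    ∃ w, HasDerivAt (P.energy θ (P.γ₃ c θ σ) t₀ u) w t ∧
      w ≤ -(min 1 (3 / 4 * c.μ)) * P.dist t₀ u t ^ 2 +
        (k' - c.k) * (2 / c.μ + θ) * P.g t * P.dist t₀ u t ^ 2 := by
  refine ⟨_, hu.hasDerivAt_energy hP ht₀ ht θ _, ?_⟩
  have hπ := Real.pi_pos.le
  have ht0 : 0 < t := ht₀.trans_lt ht
  have hu0 := hu.hasContDeriv ht.le
  have hu1 := hu.hasContDeriv_Dx ht.le
  have hv := hu.hasContDeriv_Dt ht
  have hub := hu.boundary t ht.le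
  have hvb := hu.Dt_eq_zero ht.le
  have cu := hu0.cont
  have cx := hu0.cont_deriv
  have cxx := hu1.cont_deriv
  have cv := hv.cont
  have cq := hu.continuousOn_damping hP ht
  have cF : ContinuousOn (fun x => P.F (u x t)) (Icc 0 Real.pi) :=
    hP.F_smooth.continuous.comp_continuousOn cu
  have cF' : ContinuousOn (fun x => deriv P.F (u x t)) (Icc 0 Real.pi) :=
    (hP.F_smooth.continuous_deriv (by norm_num)).comp_continuousOn cu
  have hXY := hu0.integral_deriv_sq_le hu1 hub.1 hub.2
  have hYU := hu0.integral_sq_le hub.1 hub.2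
  have hVV := hv.integral_sq_le hvb.1 hvb.2
  have hθ0 := hP.θ_pos hθ
  have hε := hP.ε_nonneg t ht0.le
  have hε0 := hP.infPos_ε_le ht0
  have hC0 := hP.infPos_C_pos
  have hCt := hP.infPos_C_le ht0
  have hCε := hP.C_sub t ht0.le
  have hμ := hP.μ_pos
  have ha := hP.a'_bound
  have haθ := hP.a'_add_θ_pos hθ
  have h2a := Assumptions.two_mul_a'_lt hθ
  have h2k := hP.two_mul_k_lt hθ
  have h5 := hP.five_lt hθ
  have hγ := hP.θ_add_two_le_γ₃ hθ hσ
  have hdamp := hP.damping_le hθ hσ hε0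
  have hεdd := infPos_le hP.ε_ddot ht0
  have hg := hP.one_le_g ht0.le
  have hεg := hP.ε_le_g ht0.le
  have hk0 := hP.k_nonneg
  set N := c.A ^ 2 * σ ^ (2 * c.τ) with hN
  have hb := fun x hx => hu.damping_bounds hP ht₀ ht hd (x := x) hx
  have i1 : 0 ≤ ∫ x in (0 : ℝ)..Real.pi, P.damping t₀ u x t * Dt t₀ u x t := by
    have h := integral_mono_Icc (f := fun _ => 0) hπ (by fun_prop) (by fun_prop)
      fun x hx => (hb x hx).1
    simpa using h
  have i2 : P.ε t * (∫ x in (0 : ℝ)..Real.pi, Dx (Dx u) x t * P.damping t₀ u x t) ≤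
      c.μ / 4 * P.ε t ^ 2 * (∫ x in (0 : ℝ)..Real.pi, Dx (Dx u) x t ^ 2)
        + N / c.μ * (∫ x in (0 : ℝ)..Real.pi, Dt t₀ u x t ^ 2) := by
    have h : ∫ x in (0 : ℝ)..Real.pi, P.ε t * (Dx (Dx u) x t * P.damping t₀ u x t) ≤
        ∫ x in (0 : ℝ)..Real.pi, ((c.μ / 4 * P.ε t ^ 2) * Dx (Dx u) x t ^ 2
          + (N / c.μ) * Dt t₀ u x t ^ 2) := by
      refine integral_mono_Icc hπ (by fun_prop) (by fun_prop) fun x hx => ?_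
      have h1 := (hb x hx).2
      have h3 : N / c.μ * Dt t₀ u x t ^ 2 = N * Dt t₀ u x t ^ 2 / c.μ := by ring
      have h4 : P.damping t₀ u x t ^ 2 / c.μ ≤ N * Dt t₀ u x t ^ 2 / c.μ :=
        div_le_div_of_nonneg_right h1 hμ.le
      have h6 : 0 ≤ (c.μ / 2 * (P.ε t * Dx (Dx u) x t) - P.damping t₀ u x t) ^ 2 / c.μ := by
        positivity
      have h7 : (c.μ / 2 * (P.ε t * Dx (Dx u) x t) - P.damping t₀ u x t) ^ 2 / c.μ =
          c.μ / 4 * P.ε t ^ 2 * Dx (Dx u) x t ^ 2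
            - P.ε t * (Dx (Dx u) x t * P.damping t₀ u x t) + P.damping t₀ u x t ^ 2 / c.μ := by
        field_simp; ring
      rw [h3]; linarith only [h4, h6, h7]
    simpa (disch := exact intervalIntegrable_of_Icc hπ (by fun_prop)) only
      [intervalIntegral.integral_add, intervalIntegral.integral_const_mul] using h
  have i3 : -(θ * (∫ x in (0 : ℝ)..Real.pi, u x t * P.damping t₀ u x t)) ≤
      θ * (infPos P.C / 4) * (∫ x in (0 : ℝ)..Real.pi, u x t ^ 2)
        + θ / infPos P.C * N * (∫ x in (0 : ℝ)..Real.pi, Dt t₀ u x t ^ 2) := by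
    have h : ∫ x in (0 : ℝ)..Real.pi, (-θ) * (u x t * P.damping t₀ u x t) ≤
        ∫ x in (0 : ℝ)..Real.pi, ((θ * (infPos P.C / 4)) * u x t ^ 2
          + (θ / infPos P.C * N) * Dt t₀ u x t ^ 2) := by
      refine integral_mono_Icc hπ (by fun_prop) (by fun_prop) fun x hx => ?_
      have h1 := (hb x hx).2
      have h4 := mul_le_mul_of_nonneg_left h1 (div_nonneg hθ0.le hC0.le)
      have h6 : 0 ≤ θ / infPos P.C * (infPos P.C / 2 * u x t + P.damping t₀ u x t) ^ 2 := by
        positivity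
      have h7 : θ / infPos P.C * (infPos P.C / 2 * u x t + P.damping t₀ u x t) ^ 2 =
          θ * (infPos P.C / 4) * u x t ^ 2 + θ * (u x t * P.damping t₀ u x t)
            + θ / infPos P.C * P.damping t₀ u x t ^ 2 := by
        field_simp; ring
      linarith only [h4, h6, h7]
    simp (disch := exact intervalIntegrable_of_Icc hπ (by fun_prop)) only
      [intervalIntegral.integral_add, intervalIntegral.integral_const_mul] at h
    linarith only [h]
  have i4 : ∫ x in (0 : ℝ)..Real.pi, deriv P.F (u x t) * Dx u x t ^ 2 ≤
      k' * ∫ x in (0 : ℝ)..Real.pi, Dx u x t ^ 2 := by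
    rw [← intervalIntegral.integral_const_mul]
    refine integral_mono_Icc hπ (by fun_prop) (by fun_prop) fun x hx => ?_
    exact mul_le_mul_of_nonneg_right (hF _ (hu.abs_le_dist ht.le (Ioo_subset_Icc_self hx)))
      (sq_nonneg _)
  have i5 : ∫ x in (0 : ℝ)..Real.pi, u x t * P.F (u x t) ≤
      k' * ∫ x in (0 : ℝ)..Real.pi, u x t ^ 2 := by
    rw [← intervalIntegral.integral_const_mul]
    refine integral_mono_Icc hπ (by fun_prop) (by fun_prop) fun x hx => ?_
    exact mul_le_of_deriv_le hP.F_smooth hP.F_zero hF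
      (hu.abs_le_dist ht.le (Ioo_subset_Icc_self hx))
  rw [hu.dist_sq ht.le]
  set γ := P.γ₃ c θ σ
  set X := ∫ x in (0 : ℝ)..Real.pi, Dx (Dx u) x t ^ 2
  set Y := ∫ x in (0 : ℝ)..Real.pi, Dx u x t ^ 2
  set U := ∫ x in (0 : ℝ)..Real.pi, u x t ^ 2
  set V := ∫ x in (0 : ℝ)..Real.pi, Dt t₀ u x t ^ 2
  set Vx := ∫ x in (0 : ℝ)..Real.pi, Dx (Dt t₀ u) x t ^ 2
  set e := P.ε t
  have hX0 : 0 ≤ X := integral_sq_nonneg _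
  have hY0 : 0 ≤ Y := integral_sq_nonneg _
  have hU0 : 0 ≤ U := integral_sq_nonneg _
  have hV0 : 0 ≤ V := integral_sq_nonneg _
  -- `ε (C - ε') ≥ μ ε + μ ε²`: the first part goes to `∫ u_x²`, a quarter of the second is spent on
  -- the nonlinear damping
  have sX : -(e * (P.C t - ddt P.ε t)) * X + c.μ / 4 * e ^ 2 * X ≤
      -(c.μ * e * Y) - 3 / 4 * c.μ * (e ^ 2 * X) := by
    have h1 := mul_le_mul_of_nonneg_right hCε (mul_nonneg hε hX0)
    have h2 := mul_le_mul_of_nonneg_left hXY (mul_nonneg hμ.le hε)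
    linarith only [h1, h2]
  have sV : -((P.a' * (1 + γ) - θ) * V) - γ * e * Vx + N / c.μ * V + θ / infPos P.C * N * V ≤
      -V := by
    have h1 : γ * e * V ≤ γ * e * Vx :=
      mul_le_mul_of_nonneg_left hVV (mul_nonneg (by linarith only [hγ, hθ0]) hε)
    have h2 : N * (1 / c.μ + θ / infPos P.C) = N / c.μ + θ / infPos P.C * N := by ring
    rw [h2] at hdamp
    have h3 : 1 ≤ P.a' * (1 + γ) - θ + γ * e - N / c.μ - θ / infPos P.C * N := by
      linarith only [hdamp, ha, hε0, hε]
    have h4 := mul_le_mul_of_nonneg_right h3 hV0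
    linarith only [h1, h4]
  -- the constant `5` in `θ₁` leaves `5 / 2` here, of which `1 / 2` is spent on the growth of `C`
  have sY : 2 ≤ θ * P.C t - ((1 + γ) * ddt P.C t - ddt (ddt P.ε) t + (P.a' + θ) * ddt P.ε t) / 2
      + c.μ * e - e * c.k - θ * c.k - θ * (infPos P.C / 4) := by
    have h1 : (P.a' + θ) * (c.μ * (1 + e)) ≤ (P.a' + θ) * (P.C t - ddt P.ε t) :=
      mul_le_mul_of_nonneg_left hCε haθ.le
    have h3 : (θ - P.a') * infPos P.C ≤ (θ - P.a') * P.C t :=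
      mul_le_mul_of_nonneg_left hCt (by linarith only [h2a, hθ0])
    have h4 : e * (2 * c.k) ≤ e * (c.μ * (P.a' + θ)) := mul_le_mul_of_nonneg_left h2k.le hε
    have h6 : 0 ≤ c.μ * e := mul_nonneg hμ.le hε
    linarith only [h1, h3, h4, h6, h5, hC, hεdd]
  have hY2 := mul_le_mul_of_nonneg_right sY hY0
  have h6 : θ * (infPos P.C / 4) * U ≤ θ * (infPos P.C / 4) * Y :=
    mul_le_mul_of_nonneg_left hYU (by positivity)
  have h7 : e * (∫ x in (0 : ℝ)..Real.pi, deriv P.F (u x t) * Dx u x t ^ 2) ≤ e * (k' * Y) :=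
    mul_le_mul_of_nonneg_left i4 hε
  have h8 : θ * (∫ x in (0 : ℝ)..Real.pi, u x t * P.F (u x t)) ≤ θ * (k' * Y) :=
    mul_le_mul_of_nonneg_left
      (i5.trans (mul_le_mul_of_nonneg_left hYU (hk0.trans hk))) hθ0.le
  have h9 : 0 ≤ (1 + γ) * ∫ x in (0 : ℝ)..Real.pi, P.damping t₀ u x t * Dt t₀ u x t :=
    mul_nonneg (by linarith only [hγ, hθ0]) i1
  have h10 : (k' - c.k) * (e + θ) * Y ≤
      (k' - c.k) * (2 / c.μ + θ) * P.g t * (e ^ 2 * X + Y + U + V) := by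
    have h11 : e + θ ≤ (2 / c.μ + θ) * P.g t := by
      linarith only [hεg, mul_le_mul_of_nonneg_left hg hθ0.le]
    have h12 : Y ≤ e ^ 2 * X + Y + U + V := by
      linarith only [mul_nonneg (sq_nonneg e) hX0, hU0, hV0]
    have h13 := mul_le_mul h11 h12 hY0 (by positivity)
    have h14 := mul_le_mul_of_nonneg_left h13 (sub_nonneg.2 hk)
    linarith only [h14]
  have h11 : min 1 (3 / 4 * c.μ) * (e ^ 2 * X + Y + U + V) ≤
      3 / 4 * c.μ * (e ^ 2 * X) + 2 * Y + V := by
    have m1 := mul_le_mul_of_nonneg_right (min_le_right 1 (3 / 4 * c.μ))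
      (mul_nonneg (sq_nonneg e) hX0)
    have m2 := min_le_left 1 (3 / 4 * c.μ)
    have m3 := mul_le_mul_of_nonneg_right m2 hY0
    have m4 := mul_le_mul_of_nonneg_right m2 hU0
    have m5 := mul_le_mul_of_nonneg_right m2 hV0
    linarith only [m1, m3, m4, m5, hYU]
  linarith only [sX, sV, hY2, h6, h7, h8, h9, h10, h11, i2, i3]

end IsSolution

/-! ### The decay estimate -/

theorem Assumptions.continuousOn_g (hP : P.Assumptions c) : ContinuousOn P.g (Ici 0) := by
  have h1 := hP.differentiableOn_C.continuousOn
  have h2 := hP.differentiableOn_ddt_ε.continuousOn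
  unfold g
  fun_prop

theorem Assumptions.continuousOn_one_div_g (hP : P.Assumptions c) :
    ContinuousOn (fun t => 1 / P.g t) (Ici 0) :=
  continuousOn_const.div hP.continuousOn_g fun t ht => by linarith [hP.one_le_g ht]

theorem Assumptions.rate_pos (hP : P.Assumptions c) {θ σ : ℝ} (hθ : P.θ₂ c < θ) (hσ : 0 ≤ σ) :
    0 < P.rate c θ σ := by
  have h1 := m_nonneg hP.F_smooth hσ
  have h2 := hP.θ_add_two_le_γ₃ hθ hσ
  have h3 := hP.θ_pos hθ
  have h4 := hP.μ_pos
  have h5 : 0 < min 1 (3 / 4 * c.μ) := lt_min one_pos (by positivity)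
  have h6 : 0 < 1 + P.γ₃ c θ σ := by linarith
  unfold rate
  positivity

theorem Assumptions.rate_anti (hP : P.Assumptions c) {θ σ σ' : ℝ} (hθ : P.θ₂ c < θ) (hσ : 0 ≤ σ)
    (h : σ ≤ σ') : P.rate c θ σ' ≤ P.rate c θ σ := by
  have h1 := m_nonneg hP.F_smooth hσ
  have h2 := hP.θ_add_two_le_γ₃ hθ hσ
  have h3 := hP.θ_pos hθ
  have h4 := hP.μ_pos
  have h5 : 0 < min 1 (3 / 4 * c.μ) := lt_min one_pos (by positivity)
  have h6 : 0 < 1 + P.γ₃ c θ σ := by linarith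
  have h7 := m_mono hP.F_smooth hσ h
  have h8 := hP.γ₃_mono hθ hσ h
  unfold rate
  refine div_le_div_of_nonneg_left h5.le (by positivity) ?_
  exact mul_le_mul (by linarith) (by linarith) h6.le (by linarith)

theorem lower_le_one (hP : P.Assumptions c) {θ : ℝ} (hθ : P.θ₂ c < θ) : P.lower θ ≤ 1 := by
  have h1 := hP.infPos_C_pos
  have h2 := hP.θ_pos hθ
  have h3 : 0 ≤ 8 * (θ ^ 2 + |P.a'| * θ + 1) / infPos P.C := by positivity
  unfold lower
  rw [div_le_one (by linarith)]
  linarith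

/-- The errors `σ` for which the functional with weight `γ₃(σ)` controls the solutions starting at
times `t₀ ≥ κ`. -/
structure Admissible (P : Problem) (c : Constants) (θ κ σ : ℝ) : Prop where
  pos : 0 < σ
  lt_ρ : σ < c.ρ
  small : (1 + P.γ₃ c θ σ) * (c.h * σ ^ c.ω) ≤ infPos P.C / 4
  ddt_C_le : ∀ t, κ < t → (1 + P.γ₃ c θ σ) * ddt P.C t ≤ 1

theorem Admissible.mono (hP : P.Assumptions c) {θ κ σ σ' : ℝ} (hθ : P.θ₂ c < θ)
    (h : P.Admissible c θ κ σ') (hσ : 0 < σ) (hle : σ ≤ σ') : P.Admissible c θ κ σ where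
  pos := hσ
  lt_ρ := hle.trans_lt h.lt_ρ
  small := by
    have h1 := hP.γ₃_mono hθ hσ.le hle
    have h2 := Real.rpow_le_rpow hσ.le hle hP.ω_pos.le
    have h3 := hP.θ_add_two_le_γ₃ hθ hσ.le
    have h4 := hP.θ_pos hθ
    refine le_trans ?_ h.small
    exact mul_le_mul (by linarith) (mul_le_mul_of_nonneg_left h2 hP.h_nonneg)
      (mul_nonneg hP.h_nonneg (Real.rpow_nonneg hσ.le _)) (by linarith)
  ddt_C_le t ht := by
    have h1 := hP.γ₃_mono hθ hσ.le hle
    have h3 := hP.θ_add_two_le_γ₃ hθ hσ.le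
    have h4 := hP.θ_pos hθ
    have h5 := h.ddt_C_le t ht
    rcases le_total (ddt P.C t) 0 with h6 | h6
    · have := mul_nonneg (by linarith : 0 ≤ 1 + P.γ₃ c θ σ) (neg_nonneg.2 h6)
      linarith
    · exact (mul_le_mul_of_nonneg_right (by linarith) h6).trans h5

/-- The constant in front of the nonlinear term of the differential inequality, expressed through
the Liapunov functional. -/
def growth (P : Problem) (c : Constants) (θ : ℝ) : ℝ :=
  (2 / c.μ + θ) / P.lower θ ^ (c.ω / 2 + 1)

theorem growth_pos (hP : P.Assumptions c) {θ : ℝ} (hθ : P.θ₂ c < θ) : 0 < P.growth c θ := by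
  have h1 := hP.μ_pos
  have h2 := hP.θ_pos hθ
  have h3 := Real.rpow_pos_of_pos (lower_pos hP hθ) (c.ω / 2 + 1)
  unfold growth; positivity

/-- The time integral `∫_{t₀}^t ds / g(s)`. -/
def phase (P : Problem) (t₀ t : ℝ) : ℝ := ∫ s in t₀..t, 1 / P.g s

/-- The integrand `g(t) exp (-(ω λ(σ) / 2) ∫_{t₀}^t ds / g(s))`, cf. `G`. -/
def weight (P : Problem) (c : Constants) (θ σ t₀ t : ℝ) : ℝ :=
  P.g t * Real.exp (-(c.ω * P.rate c θ σ / 2 * P.phase t₀ t))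

theorem Assumptions.continuousOn_phase (hP : P.Assumptions c) {t₀ : ℝ} (ht₀ : 0 ≤ t₀) :
    ContinuousOn (P.phase t₀) (Ici t₀) :=
  continuousOn_primitive (hP.continuousOn_one_div_g.mono (Ici_subset_Ici.2 ht₀))

theorem Assumptions.hasDerivAt_phase (hP : P.Assumptions c) {t₀ t : ℝ} (ht₀ : 0 ≤ t₀)
    (ht : t₀ < t) : HasDerivAt (P.phase t₀) (1 / P.g t) t :=
  hasDerivAt_primitive (hP.continuousOn_one_div_g.mono (Ici_subset_Ici.2 ht₀)) ht

theorem Assumptions.phase_nonneg (hP : P.Assumptions c) {t₀ t : ℝ} (ht₀ : 0 ≤ t₀)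
    (ht : t₀ ≤ t) : 0 ≤ P.phase t₀ t :=
  intervalIntegral.integral_nonneg ht fun s hs =>
    one_div_nonneg.2 (by linarith [hP.one_le_g (ht₀.trans hs.1)])

theorem Assumptions.continuousOn_weight (hP : P.Assumptions c) {t₀ : ℝ} (θ σ : ℝ)
    (ht₀ : 0 ≤ t₀) : ContinuousOn (P.weight c θ σ t₀) (Ici t₀) := by
  have h1 := hP.continuousOn_g.mono (Ici_subset_Ici.2 ht₀)
  have h2 := hP.continuousOn_phase ht₀
  unfold weight
  fun_prop

theorem Assumptions.weight_nonneg (hP : P.Assumptions c) {t₀ t : ℝ} (θ σ : ℝ)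
    (ht : 0 ≤ t) : 0 ≤ P.weight c θ σ t₀ t :=
  mul_nonneg (by linarith [hP.one_le_g ht]) (Real.exp_nonneg _)

namespace IsSolution

variable {t₀ t : ℝ} {u : ℝ → ℝ → ℝ}

theorem continuousOn_dist (hP : P.Assumptions c) (hu : P.IsSolution t₀ u) (ht₀ : 0 ≤ t₀) :
    ContinuousOn (P.dist t₀ u) (Ici t₀) := by
  have h1 := hu.cont
  have h2 := hu.cont_x
  have h3 := hu.cont_xx
  have h4 := hu.cont_t
  have h5 : ContinuousOn (fun p : ℝ × ℝ => P.ε p.2) (Icc 0 Real.pi ×ˢ Ici t₀) :=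
    hP.differentiableOn_ε.continuousOn.comp (by fun_prop) fun p hp => ht₀.trans hp.2
  refine Real.continuous_sqrt.comp_continuousOn (continuousOn_integral_param
    (f := fun x t => P.ε t ^ 2 * Dx (Dx u) x t ^ 2 + Dx u x t ^ 2 + u x t ^ 2 + Dt t₀ u x t ^ 2)
    Real.pi_pos.le ?_)
  fun_prop

theorem continuousOn_energy (hP : P.Assumptions c) (hu : P.IsSolution t₀ u) (ht₀ : 0 ≤ t₀)
    (θ γ : ℝ) : ContinuousOn (P.energy θ γ t₀ u) (Ici t₀) := by
  have hπ := Real.pi_pos.le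
  have h1 := hu.cont
  have h2 := hu.cont_x
  have h3 := hu.cont_xx
  have h4 := hu.cont_t
  have h5 : ContinuousOn (fun p : ℝ × ℝ => P.ε p.2) (Icc 0 Real.pi ×ˢ Ici t₀) :=
    hP.differentiableOn_ε.continuousOn.comp (by fun_prop) fun p hp => ht₀.trans hp.2
  have kε := hP.differentiableOn_ε.continuousOn.mono (Ici_subset_Ici.2 ht₀)
  have kε' := hP.differentiableOn_ddt_ε.continuousOn.mono (Ici_subset_Ici.2 ht₀)
  have kC := hP.differentiableOn_C.continuousOn.mono (Ici_subset_Ici.2 ht₀)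
  have j1 := continuousOn_integral_param
    (f := fun x t => (P.ε t * Dx (Dx u) x t - Dt t₀ u x t) ^ 2) hπ (by fun_prop)
  have j2 := continuousOn_integral_param (f := fun x t => Dt t₀ u x t ^ 2) hπ (by fun_prop)
  have j3 := continuousOn_integral_param (f := fun x t => u x t * Dt t₀ u x t) hπ (by fun_prop)
  have j4 := continuousOn_integral_param (f := fun x t => Dx u x t ^ 2) hπ (by fun_prop)
  have j5 := continuousOn_integral_param (f := fun x t => u x t ^ 2) hπ (by fun_prop)
  have j6 := continuousOn_integral_param (f := fun x t => ∫ y in (0 : ℝ)..u x t, P.F y) hπ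
    ((continuous_integral_F hP.F_smooth).comp_continuousOn h1)
  have j : ContinuousOn (fun t =>
      (∫ x in (0 : ℝ)..Real.pi, (P.ε t * Dx (Dx u) x t - Dt t₀ u x t) ^ 2) / 2
      + γ / 2 * (∫ x in (0 : ℝ)..Real.pi, Dt t₀ u x t ^ 2)
      + θ * (∫ x in (0 : ℝ)..Real.pi, u x t * Dt t₀ u x t)
      + (P.C t * (1 + γ) - ddt P.ε t + P.ε t * (P.a' + θ)) / 2 *
          (∫ x in (0 : ℝ)..Real.pi, Dx u x t ^ 2)
      + P.a' * θ / 2 * (∫ x in (0 : ℝ)..Real.pi, u x t ^ 2)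
      - (1 + γ) * ∫ x in (0 : ℝ)..Real.pi, ∫ y in (0 : ℝ)..u x t, P.F y) (Ici t₀) := by
    fun_prop
  exact j

/-- The differential inequality in terms of the functional alone, as long as
`W e^{λ ∫ ds / g} < S`. -/
theorem exists_deriv_energy_le_mul (hP : P.Assumptions c) (hu : P.IsSolution t₀ u)
    {θ κ σ S : ℝ} (hθ : P.θ₂ c < θ) (hσ : P.Admissible c θ κ σ) (ht₀ : 0 ≤ t₀) (hκ : κ ≤ t₀)
    (ht : t₀ < t) (hd : P.dist t₀ u t < σ)
    (hS : P.energy θ (P.γ₃ c θ σ) t₀ u t * Real.exp (P.rate c θ σ * P.phase t₀ t) < S) :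
    ∃ w, HasDerivAt (P.energy θ (P.γ₃ c θ σ) t₀ u) w t ∧
      w ≤ (-(P.rate c θ σ * (1 / P.g t)) +
          P.growth c θ * S ^ (c.ω / 2) * (c.h * P.weight c θ σ t₀ t)) *
        P.energy θ (P.γ₃ c θ σ) t₀ u t := by
  have hσ0 := hσ.pos.le
  have hd0 : 0 ≤ P.dist t₀ u t := Real.sqrt_nonneg _
  have ht0 : 0 < t := ht₀.trans_lt ht
  have hh := hP.h_nonneg
  have hdω := Real.rpow_nonneg hd0 c.ω
  have hF : ∀ z, |z| ≤ P.dist t₀ u t →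
      deriv P.F z ≤ c.k + c.h * P.dist t₀ u t ^ c.ω := fun z hz =>
    (hP.F_deriv z (hz.trans_lt (hd.trans hσ.lt_ρ))).trans (by
      have := mul_le_mul_of_nonneg_left (Real.rpow_le_rpow (abs_nonneg z) hz hP.ω_pos.le) hh
      linarith)
  have hγ := hP.θ_add_two_le_γ₃ hθ hσ0
  have hθ0 := hP.θ_pos hθ
  obtain ⟨w, hw, hle⟩ := hu.exists_deriv_energy_le hP ht₀ ht hθ hσ0 hd.le
    (hσ.ddt_C_le t (hκ.trans_lt ht)) hF (le_add_of_nonneg_right (mul_nonneg hh hdω))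
  refine ⟨w, hw, hle.trans ?_⟩
  have hlow : P.lower θ * P.dist t₀ u t ^ 2 ≤ P.energy θ (P.γ₃ c θ σ) t₀ u t :=
    lower_mul_le_liapunov hP hθ hσ0 ht0 (hu.hasContDeriv ht.le) (hu.hasContDeriv_Dx ht.le)
      (hu.continuousOn_Dt ht.le) (hu.boundary t ht.le).1 (hu.boundary t ht.le).2 hF
      (by have := mul_nonneg hh hdω; linarith [hP.k_nonneg]) (by
        refine le_trans ?_ hσ.small
        have := mul_le_mul_of_nonneg_left (Real.rpow_le_rpow hd0 hd.le hP.ω_pos.le) hh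
        rw [add_sub_cancel_left]
        exact mul_le_mul_of_nonneg_left this (by linarith))
  have hup : P.energy θ (P.γ₃ c θ σ) t₀ u t ≤
      (1 + P.m σ) * (1 + P.γ₃ c θ σ) * P.g t * P.dist t₀ u t ^ 2 :=
    liapunov_le hP hθ hσ0 ht0.le (hu.hasContDeriv ht.le) (hu.hasContDeriv_Dx ht.le)
      (hu.continuousOn_Dt ht.le) (hu.boundary t ht.le).1 (hu.boundary t ht.le).2 hd.le
  set W := P.energy θ (P.γ₃ c θ σ) t₀ u t
  set d := P.dist t₀ u t
  set χ := P.lower θ with hχ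
  have hχ0 : 0 < χ := lower_pos hP hθ
  have hW0 : 0 ≤ W := (mul_nonneg hχ0.le (sq_nonneg d)).trans hlow
  have hg := hP.one_le_g ht0.le
  have hm := m_nonneg hP.F_smooth hσ0
  have hη : 0 ≤ min 1 (3 / 4 * c.μ) := le_min zero_le_one (by linarith [hP.μ_pos])
  have hp : 0 ≤ c.ω / 2 := by linarith [hP.ω_pos]
  have h1 : P.rate c θ σ * (1 / P.g t) * W ≤ min 1 (3 / 4 * c.μ) * d ^ 2 := by
    have hK : 0 < (1 + P.m σ) * (1 + P.γ₃ c θ σ) := mul_pos (by linarith) (by linarith)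
    have h2 : P.rate c θ σ * (1 / P.g t) * W =
        min 1 (3 / 4 * c.μ) * (W / ((1 + P.m σ) * (1 + P.γ₃ c θ σ) * P.g t)) := by
      unfold rate; field_simp
    rw [h2]
    refine mul_le_mul_of_nonneg_left ?_ hη
    rw [div_le_iff₀ (mul_pos hK (by linarith))]
    linarith only [hup]
  have hdW : d ^ 2 ≤ W / χ := by rw [le_div_iff₀ hχ0]; linarith only [hlow]
  have hdp : d ^ c.ω ≤ (W / χ) ^ (c.ω / 2) := by
    have h3 := Real.rpow_le_rpow (sq_nonneg d) hdW hp
    rwa [← Real.rpow_natCast, ← Real.rpow_mul hd0,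
      show ((2 : ℕ) : ℝ) * (c.ω / 2) = c.ω by push_cast; ring] at h3
  have hWS : W ^ (c.ω / 2) ≤ S ^ (c.ω / 2) *
      Real.exp (-(c.ω * P.rate c θ σ / 2 * P.phase t₀ t)) := by
    have h3 : W ≤ S * Real.exp (-(P.rate c θ σ * P.phase t₀ t)) := by
      rw [Real.exp_neg, ← div_eq_mul_inv, le_div_iff₀ (Real.exp_pos _)]
      exact hS.le
    have hS0 : 0 ≤ S := (mul_nonneg hW0 (Real.exp_nonneg _)).trans hS.le
    have h4 := Real.rpow_le_rpow hW0 h3 hp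
    rw [Real.mul_rpow hS0 (Real.exp_nonneg _), ← Real.exp_mul] at h4
    convert h4 using 3
    ring
  have h5 : c.h * d ^ c.ω * (2 / c.μ + θ) * P.g t * d ^ 2 ≤
      P.growth c θ * S ^ (c.ω / 2) * (c.h * P.weight c θ σ t₀ t) * W := by
    have h6 : d ^ c.ω * d ^ 2 ≤ (W / χ) ^ (c.ω / 2) * (W / χ) :=
      mul_le_mul hdp hdW (sq_nonneg d) (Real.rpow_nonneg (div_nonneg hW0 hχ0.le) _)
    have h7 : (W / χ) ^ (c.ω / 2) * (W / χ) = W ^ (c.ω / 2) * W / χ ^ (c.ω / 2 + 1) := by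
      rw [Real.div_rpow hW0 hχ0.le, Real.rpow_add_one hχ0.ne']
      field_simp
    have h8 : W ^ (c.ω / 2) * W / χ ^ (c.ω / 2 + 1) ≤ S ^ (c.ω / 2) *
        Real.exp (-(c.ω * P.rate c θ σ / 2 * P.phase t₀ t)) * W / χ ^ (c.ω / 2 + 1) :=
      div_le_div_of_nonneg_right (mul_le_mul_of_nonneg_right hWS hW0)
        (Real.rpow_nonneg hχ0.le _)
    have h9 : 0 ≤ c.h * (2 / c.μ + θ) * P.g t :=
      mul_nonneg (mul_nonneg hh (add_nonneg (div_nonneg zero_le_two hP.μ_pos.le) hθ0.le))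
        (by linarith)
    have h10 := mul_le_mul_of_nonneg_left (h6.trans (h7.le.trans h8)) h9
    have h11 : P.growth c θ * S ^ (c.ω / 2) * (c.h * P.weight c θ σ t₀ t) * W =
        c.h * (2 / c.μ + θ) * P.g t * (S ^ (c.ω / 2) *
        Real.exp (-(c.ω * P.rate c θ σ / 2 * P.phase t₀ t)) * W / χ ^ (c.ω / 2 + 1)) := by
      unfold growth weight
      rw [← hχ]
      ring
    rw [h11]
    linarith only [h10]
  linarith only [h1, h5]

/-- The decay estimate. As long as `d < σ` and `W e^{λ ∫ ds / g} < S`, the differential inequality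
is linear in `W`, and the integral of the coefficient of its growing part is at most `log 2`. Hence
`W e^{λ ∫ ds / g}` at most doubles, so that neither bound is ever attained. -/
theorem dist_lt_and_sq_le (hP : P.Assumptions c) (hu : P.IsSolution t₀ u)
    {θ κ σ S M : ℝ} (hθ : P.θ₂ c < θ) (hσ : P.Admissible c θ κ σ) (ht₀ : 0 ≤ t₀) (hκ : κ ≤ t₀)
    (hM : ∀ t, t₀ ≤ t → c.h * ∫ s in t₀..t, P.weight c θ σ t₀ s ≤ M)
    (hS0 : 0 < S) (hSσ : S ≤ P.lower θ * σ ^ 2)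
    (hSM : P.growth c θ * S ^ (c.ω / 2) * M ≤ Real.log 2)
    (hd : P.dist t₀ u t₀ < σ)
    (hdS : 2 * ((1 + P.m σ) * (1 + P.γ₃ c θ σ)) * P.g t₀ * P.dist t₀ u t₀ ^ 2 < S) :
    ∀ t, t₀ ≤ t → P.dist t₀ u t < σ ∧ P.lower θ * P.dist t₀ u t ^ 2 ≤
      2 * ((1 + P.m σ) * (1 + P.γ₃ c θ σ)) * P.g t₀ * P.dist t₀ u t₀ ^ 2 *
        Real.exp (-(P.rate c θ σ * P.phase t₀ t)) := by
  have hσ0 := hσ.pos.le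
  have hγ := hP.θ_add_two_le_γ₃ hθ hσ0
  have hθ0 := hP.θ_pos hθ
  have hχ := lower_pos hP hθ
  have hm := m_nonneg hP.F_smooth hσ0
  have hg₀ := hP.one_le_g ht₀
  have hrate := hP.rate_pos hθ hσ0
  have hB := (mul_nonneg (growth_pos hP hθ).le (Real.rpow_nonneg hS0.le (c.ω / 2)))
  have hWc := hu.continuousOn_energy hP ht₀ θ (P.γ₃ c θ σ)
  have hdc := hu.continuousOn_dist hP ht₀
  have hLc := hP.continuousOn_phase ht₀
  have hnc := hP.continuousOn_weight θ σ ht₀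
  have hW0 : P.energy θ (P.γ₃ c θ σ) t₀ u t₀ ≤
      (1 + P.m σ) * (1 + P.γ₃ c θ σ) * P.g t₀ * P.dist t₀ u t₀ ^ 2 :=
    liapunov_le hP hθ hσ0 ht₀ (hu.hasContDeriv le_rfl) (hu.hasContDeriv_Dx le_rfl)
      (hu.continuousOn_Dt le_rfl) (hu.boundary t₀ self_mem_Ici).1 (hu.boundary t₀ self_mem_Ici).2
      hd.le
  have hK1 : 1 ≤ (1 + P.m σ) * (1 + P.γ₃ c θ σ) * P.g t₀ :=
    one_le_mul_of_one_le_of_one_le (one_le_mul_of_one_le_of_one_le (by linarith) (by linarith)) hg₀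
  set R := (1 + P.m σ) * (1 + P.γ₃ c θ σ) * P.g t₀ * P.dist t₀ u t₀ ^ 2 with hR
  have hR0 : 0 ≤ R := mul_nonneg (by linarith) (sq_nonneg _)
  have hR2 : 2 * ((1 + P.m σ) * (1 + P.γ₃ c θ σ)) * P.g t₀ * P.dist t₀ u t₀ ^ 2 = 2 * R := by
    rw [hR]; ring
  rw [hR2] at hdS ⊢
  set W := P.energy θ (P.γ₃ c θ σ) t₀ u with hWdef
  set L := P.phase t₀ with hLdef
  have hL0 : L t₀ = 0 := intervalIntegral.integral_same
  have step : ∀ t, t₀ < t →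
      (∀ s ∈ Ico t₀ t, P.dist t₀ u s < σ ∧ W s * Real.exp (P.rate c θ σ * L s) < S) →
      W t * Real.exp (P.rate c θ σ * L t) < S ∧ P.dist t₀ u t < σ ∧
        P.lower θ * P.dist t₀ u t ^ 2 ≤ 2 * R * Real.exp (-(P.rate c θ σ * L t)) := by
    intro t ht hs
    have hdt : P.dist t₀ u t ≤ σ := by
      have h1 : Tendsto (P.dist t₀ u) (𝓝[<] t) (𝓝 (P.dist t₀ u t)) :=
        (hdc.continuousAt (Ici_mem_nhds ht)).mono_left nhdsWithin_le_nhds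
      refine le_of_tendsto h1 ?_
      filter_upwards [Ico_mem_nhdsLT ht] with s hs' using (hs s hs').1.le
    set b := P.growth c θ * S ^ (c.ω / 2) with hb
    set E : ℝ → ℝ := fun s => P.rate c θ σ * L s - b * (c.h * ∫ r in t₀..s, P.weight c θ σ t₀ r)
      with hE
    have hEc : ContinuousOn E (Ici t₀) := by
      have := continuousOn_primitive hnc
      fun_prop
    have hEd : ∀ s, t₀ < s → HasDerivAt E
        (P.rate c θ σ * (1 / P.g s) - b * (c.h * P.weight c θ σ t₀ s)) s := fun s hs' =>
      ((hP.hasDerivAt_phase ht₀ hs').const_mul _).sub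
        (((hasDerivAt_primitive hnc hs').const_mul _).const_mul _)
    have hanti : AntitoneOn (fun s => W s * Real.exp (E s)) (Icc t₀ t) := by
      have hder : ∀ s ∈ Ioo t₀ t, ∃ y ≤ 0, HasDerivAt (fun s => W s * Real.exp (E s)) y s := by
        intro s hs'
        obtain ⟨w, hw, hle⟩ := hu.exists_deriv_energy_le_mul hP hθ hσ ht₀ hκ hs'.1
          (hs s ⟨hs'.1.le, hs'.2⟩).1 (hs s ⟨hs'.1.le, hs'.2⟩).2
        refine ⟨_, ?_, hw.mul (hEd s hs'.1).exp⟩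
        have h2 : w + W s * (P.rate c θ σ * (1 / P.g s) - b * (c.h * P.weight c θ σ t₀ s)) ≤ 0 := by
          linarith only [hle]
        have h3 := mul_nonneg (neg_nonneg.2 h2) (Real.exp_nonneg (E s))
        linarith only [h3]
      refine antitoneOn_of_deriv_nonpos (convex_Icc _ _) ?_ ?_ ?_
      · exact (hWc.mono Icc_subset_Ici_self).mul
          (Real.continuous_exp.comp_continuousOn (hEc.mono Icc_subset_Ici_self))
      · rw [interior_Icc]
        intro s hs'
        obtain ⟨y, -, hy⟩ := hder s hs'
        exact hy.differentiableAt.differentiableWithinAt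
      · rw [interior_Icc]
        intro s hs'
        obtain ⟨y, hy0, hy⟩ := hder s hs'
        rw [hy.deriv]
        exact hy0
    have h1 := hanti (left_mem_Icc.2 ht.le) (right_mem_Icc.2 ht.le) ht.le
    have hE0 : E t₀ = 0 := by simp [hE, hL0]
    simp only [hE0, Real.exp_zero, mul_one] at h1
    have h2 : W t * Real.exp (P.rate c θ σ * L t) ≤ 2 * R := by
      have h3 : Real.exp (P.rate c θ σ * L t) = Real.exp (E t) *
          Real.exp (b * (c.h * ∫ r in t₀..t, P.weight c θ σ t₀ r)) := by
        rw [← Real.exp_add, hE]; congr 1; ring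
      have h4 : Real.exp (b * (c.h * ∫ r in t₀..t, P.weight c θ σ t₀ r)) ≤ 2 := by
        rw [← Real.le_log_iff_exp_le two_pos]
        exact (mul_le_mul_of_nonneg_left (hM t ht.le) hB).trans hSM
      have h5 := mul_le_mul_of_nonneg_right (h1.trans hW0)
        (Real.exp_nonneg (b * (c.h * ∫ r in t₀..t, P.weight c θ σ t₀ r)))
      have h6 := mul_le_mul_of_nonneg_left h4 hR0
      rw [h3, ← mul_assoc]
      linarith only [h5, h6]
    have hlow : P.lower θ * P.dist t₀ u t ^ 2 ≤ W t := by
      have hσω := Real.rpow_nonneg hσ0 c.ω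
      refine lower_mul_le_liapunov (k' := c.k + c.h * σ ^ c.ω) hP hθ hσ0 (ht₀.trans_lt ht)
        (hu.hasContDeriv ht.le) (hu.hasContDeriv_Dx ht.le)
        (hu.continuousOn_Dt ht.le) (hu.boundary t ht.le).1 (hu.boundary t ht.le).2 ?_ ?_ ?_
      · intro z hz
        have h3 := hP.F_deriv z ((hz.trans hdt).trans_lt hσ.lt_ρ)
        have h4 := mul_le_mul_of_nonneg_left
          (Real.rpow_le_rpow (abs_nonneg z) (hz.trans hdt) hP.ω_pos.le) hP.h_nonneg
        linarith only [h3, h4]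
      · have := mul_nonneg hP.h_nonneg hσω
        linarith [hP.k_nonneg]
      · rw [add_sub_cancel_left]
        exact hσ.small
    have h3 : W t ≤ 2 * R * Real.exp (-(P.rate c θ σ * L t)) := by
      rwa [Real.exp_neg, ← div_eq_mul_inv, le_div_iff₀ (Real.exp_pos _)]
    refine ⟨h2.trans_lt hdS, ?_, hlow.trans h3⟩
    have h4 : Real.exp (-(P.rate c θ σ * L t)) ≤ 1 := Real.exp_le_one_iff.2
      (neg_nonpos.2 (mul_nonneg hrate.le (hP.phase_nonneg ht₀ ht.le)))
    have h5 : 2 * R * Real.exp (-(P.rate c θ σ * L t)) ≤ 2 * R :=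
      mul_le_of_le_one_right (by linarith) h4
    have h6 : P.lower θ * P.dist t₀ u t ^ 2 < P.lower θ * σ ^ 2 := by
      linarith only [hlow, h3, h5, hdS, hSσ]
    exact lt_of_pow_lt_pow_left₀ 2 hσ0 (lt_of_mul_lt_mul_left h6 hχ.le)
  have hall : ∀ t ∈ Ici t₀,
      max (P.dist t₀ u t - σ) (W t * Real.exp (P.rate c θ σ * L t) - S) < 0 := by
    refine lt_of_continuous_induction ?_ ?_ fun t ht hs => ?_
    · have : ContinuousOn (fun t => Real.exp (P.rate c θ σ * L t)) (Ici t₀) :=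
        Real.continuous_exp.comp_continuousOn (continuousOn_const.mul hLc)
      exact (hdc.sub continuousOn_const).sup ((hWc.mul this).sub continuousOn_const)
    · rw [hL0, mul_zero, Real.exp_zero, mul_one]
      exact max_lt (by linarith) (by linarith)
    · obtain ⟨h1, h2, -⟩ := step t ht fun s hs' =>
        ⟨sub_neg.1 ((le_max_left _ _).trans_lt (hs s hs')),
          sub_neg.1 ((le_max_right _ _).trans_lt (hs s hs'))⟩
      exact max_lt (sub_neg.2 h2) (sub_neg.2 h1)
  intro t ht
  refine ⟨sub_neg.1 ((le_max_left _ _).trans_lt (hall t ht)), ?_⟩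
  rcases eq_or_lt_of_le ht with rfl | hlt
  · rw [hL0, mul_zero, neg_zero, Real.exp_zero, mul_one]
    have h1 : P.lower θ * P.dist t₀ u t₀ ^ 2 ≤
        (1 + P.m σ) * (1 + P.γ₃ c θ σ) * P.g t₀ * P.dist t₀ u t₀ ^ 2 :=
      mul_le_mul_of_nonneg_right ((lower_le_one hP hθ).trans hK1) (sq_nonneg _)
    linarith only [h1, hR0, hR]
  · exact (step t hlt fun s hs =>
      ⟨sub_neg.1 ((le_max_left _ _).trans_lt (hall s hs.1)),
        sub_neg.1 ((le_max_right _ _).trans_lt (hall s hs.1))⟩).2.2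

end IsSolution

/-! ### Choice of the constants, and bounds for the perturbation integral -/

theorem Assumptions.exists_admissible (hP : P.Assumptions c) {θ : ℝ} (hθ : P.θ₂ c < θ)
    (hC : (∀ t ∈ Ici (0 : ℝ), ddt P.C t ≤ 0) ∨ Tendsto (ddt P.C) atTop (𝓝 0)) :
    ∃ κ ξ : ℝ, 0 ≤ κ ∧ ((∀ t ∈ Ici (0 : ℝ), ddt P.C t ≤ 0) → κ = 0) ∧
      P.Admissible c θ κ ξ := by
  have h2 := hP.θ_add_two_le_γ₃ hθ zero_le_one
  have h3 := hP.θ_pos hθ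
  have h4 := hP.infPos_C_pos
  have h5 := hP.h_nonneg
  have h6 : 0 < 1 + P.γ₃ c θ 1 := by linarith
  -- `ξ ≤ 1`, so that `γ₃(ξ) ≤ γ₃(1)` can be fixed before `ξ` is chosen
  obtain ⟨ξ, hξ0, hξ1, hξ2⟩ := exists_pos_rpow_le hP.ω_pos
    (lt_min one_pos (half_pos hP.ρ_pos))
    (show 0 < infPos P.C / 4 / ((1 + P.γ₃ c θ 1) * (c.h + 1)) by positivity)
  have hγ := hP.γ₃_mono hθ hξ0.le (hξ1.trans (min_le_left _ _))
  have hγ0 := hP.θ_add_two_le_γ₃ hθ hξ0.le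
  have hρ : ξ < c.ρ := (hξ1.trans (min_le_right _ _)).trans_lt (half_lt_self hP.ρ_pos)
  have hsmall : (1 + P.γ₃ c θ ξ) * (c.h * ξ ^ c.ω) ≤ infPos P.C / 4 := by
    rw [le_div_iff₀ (by positivity)] at hξ2
    refine le_trans ?_ hξ2
    have h7 := Real.rpow_nonneg hξ0.le c.ω
    have h8 : c.h * ξ ^ c.ω ≤ (c.h + 1) * ξ ^ c.ω :=
      mul_le_mul_of_nonneg_right (by linarith) h7
    have h9 := mul_le_mul (by linarith : 1 + P.γ₃ c θ ξ ≤ 1 + P.γ₃ c θ 1) h8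
      (mul_nonneg h5 h7) h6.le
    linarith only [h9]
  by_cases hle : ∀ t ∈ Ici (0 : ℝ), ddt P.C t ≤ 0
  · refine ⟨0, ξ, le_rfl, fun _ => rfl, hξ0, hρ, hsmall, fun t ht => ?_⟩
    have := mul_nonneg (by linarith : 0 ≤ 1 + P.γ₃ c θ ξ) (neg_nonneg.2 (hle t (le_of_lt ht)))
    linarith
  · have hlim := hC.resolve_left hle
    have hpos : 0 < 1 + P.γ₃ c θ ξ := by linarith
    obtain ⟨κ, hκ⟩ := eventually_atTop.1 (hlim.eventually_lt_const (one_div_pos.2 hpos))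
    refine ⟨max κ 0, ξ, le_max_right _ _, fun h => absurd h hle, hξ0, hρ, hsmall, fun t ht => ?_⟩
    have := hκ t ((le_max_left _ _).trans ht.le)
    rw [lt_div_iff₀ hpos] at this
    linarith

theorem Assumptions.exists_threshold (hP : P.Assumptions c) {θ σ M : ℝ} (hθ : P.θ₂ c < θ)
    (hσ : 0 < σ) (hM : 0 ≤ M) :
    ∃ S : ℝ, 0 < S ∧ S ≤ P.lower θ * σ ^ 2 ∧
      P.growth c θ * S ^ (c.ω / 2) * M ≤ Real.log 2 := by
  have h1 := growth_pos hP hθ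
  have h2 := lower_pos hP hθ
  have h3 : 0 < Real.log 2 := Real.log_pos one_lt_two
  have h4 : 0 < P.growth c θ * (M + 1) := by positivity
  obtain ⟨S, hS0, hS1, hS2⟩ := exists_pos_rpow_le (half_pos hP.ω_pos)
    (show 0 < P.lower θ * σ ^ 2 by positivity)
    (show 0 < Real.log 2 / (P.growth c θ * (M + 1)) by positivity)
  refine ⟨S, hS0, hS1, ?_⟩
  rw [le_div_iff₀ h4] at hS2
  have h5 := mul_nonneg (Real.rpow_nonneg hS0.le (c.ω / 2)) h1.le
  linarith only [hS2, h5]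

theorem Assumptions.phase_add (hP : P.Assumptions c) {t₀ t : ℝ} (ht₀ : 0 ≤ t₀) (ht : t₀ ≤ t) :
    P.phase 0 t = P.phase 0 t₀ + P.phase t₀ t := by
  have h := hP.continuousOn_one_div_g
  exact (intervalIntegral.integral_add_adjacent_intervals
    (intervalIntegrable_of_Icc ht₀ (h.mono Icc_subset_Ici_self))
    (intervalIntegrable_of_Icc ht (h.mono fun s hs => ht₀.trans hs.1))).symm

theorem Assumptions.phase_mono (hP : P.Assumptions c) {t₀ s t : ℝ} (ht₀ : 0 ≤ t₀) (hs : t₀ ≤ s)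
    (hst : s ≤ t) : P.phase t₀ s ≤ P.phase t₀ t := by
  have h1 := hP.phase_add ht₀ hs
  have h2 := hP.phase_add ht₀ (hs.trans hst)
  have h3 := hP.phase_add (ht₀.trans hs) hst
  have h4 := hP.phase_nonneg (ht₀.trans hs) hst
  linarith

theorem Assumptions.G_mono (hP : P.Assumptions c) {θ σ σ' : ℝ} (hθ : P.θ₂ c < θ) (hσ : 0 ≤ σ)
    (h : σ ≤ σ') : P.G c θ σ ≤ P.G c θ σ' := by
  refine mul_le_mul_right ?_ _
  refine setLIntegral_mono' measurableSet_Ioi fun t ht => ENNReal.ofReal_le_ofReal ?_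
  have h1 := hP.one_le_g (le_of_lt ht)
  refine mul_le_mul_of_nonneg_right (Real.exp_le_exp.2 (neg_le_neg ?_)) (by linarith)
  refine mul_le_mul_of_nonneg_right ?_ (hP.phase_nonneg le_rfl (le_of_lt ht))
  have h2 := mul_le_mul_of_nonneg_left (hP.rate_anti hθ hσ h) hP.ω_pos.le
  linarith

theorem Assumptions.mul_integral_weight_le_G (hP : P.Assumptions c) {θ σ : ℝ}
    (hG : P.G c θ σ < ⊤) {t₀ t : ℝ} (ht₀ : 0 ≤ t₀) (ht : t₀ ≤ t) :
    c.h * ∫ s in t₀..t, P.weight c θ σ t₀ s ≤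
      Real.exp (c.ω * P.rate c θ σ / 2 * P.phase 0 t₀) * (P.G c θ σ).toReal := by
  have hw := (hP.continuousOn_weight θ σ le_rfl).mono (Ici_subset_Ici.2 ht₀)
  have h1 : ∫ s in t₀..t, P.weight c θ σ t₀ s =
      Real.exp (c.ω * P.rate c θ σ / 2 * P.phase 0 t₀) * ∫ s in t₀..t, P.weight c θ σ 0 s := by
    rw [← intervalIntegral.integral_const_mul]
    refine intervalIntegral.integral_congr fun s hs => ?_
    rw [uIcc_of_le ht] at hs
    have h2 : Real.exp (-(c.ω * P.rate c θ σ / 2 * P.phase t₀ s)) =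
        Real.exp (c.ω * P.rate c θ σ / 2 * P.phase 0 t₀) *
          Real.exp (-(c.ω * P.rate c θ σ / 2 * P.phase 0 s)) := by
      rw [← Real.exp_add, hP.phase_add ht₀ hs.1]
      congr 1; ring
    simp only [weight]
    rw [h2]; ring
  rw [h1, mul_left_comm]
  refine mul_le_mul_of_nonneg_left ?_ (Real.exp_nonneg _)
  rw [← ENNReal.ofReal_le_iff_le_toReal hG.ne, ENNReal.ofReal_mul hP.h_nonneg]
  refine mul_le_mul_right ?_ _
  rw [intervalIntegral.integral_of_le ht, ofReal_integral_eq_lintegral_ofReal]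
  · refine (lintegral_mono_set fun s hs => ht₀.trans_lt hs.1).trans_eq ?_
    refine setLIntegral_congr_fun measurableSet_Ioi fun s _ => ?_
    simp only [weight, phase]
    rw [mul_comm]
  · exact (intervalIntegrable_of_Icc ht (hw.mono Icc_subset_Ici_self)).1
  · exact (ae_restrict_mem measurableSet_Ioc).mono fun s hs =>
      hP.weight_nonneg θ σ (ht₀.trans hs.1.le)

/-- If `g` is bounded, then `g ≤ N² / g`, and the exponential times `1 / g` is an exact
derivative; the resulting bound does not depend on `t₀`. -/
theorem Assumptions.mul_integral_weight_le_of_g_le (hP : P.Assumptions c) {θ σ N : ℝ}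
    (hθ : P.θ₂ c < θ) (hσ : 0 ≤ σ) (hN : ∀ t, 0 ≤ t → P.g t ≤ N) {t₀ t : ℝ} (ht₀ : 0 ≤ t₀)
    (ht : t₀ ≤ t) :
    c.h * ∫ s in t₀..t, P.weight c θ σ t₀ s ≤ c.h * (N ^ 2 / (c.ω * P.rate c θ σ / 2)) := by
  refine mul_le_mul_of_nonneg_left ?_ hP.h_nonneg
  have hq : 0 < c.ω * P.rate c θ σ / 2 := half_pos (mul_pos hP.ω_pos (hP.rate_pos hθ hσ))
  set q := c.ω * P.rate c θ σ / 2 with hqdef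
  have hLc := hP.continuousOn_phase ht₀
  have hgc := hP.continuousOn_one_div_g.mono (Ici_subset_Ici.2 ht₀)
  have hd : HasContDeriv (fun s => -(N ^ 2 / q * Real.exp (-(q * P.phase t₀ s))))
      (fun s => N ^ 2 * (1 / P.g s) * Real.exp (-(q * P.phase t₀ s))) t₀ t := by
    have hexp : ContinuousOn (fun s => Real.exp (-(q * P.phase t₀ s))) (Ici t₀) := by fun_prop
    refine ⟨?_, ?_, fun s hs => ?_⟩
    · exact ((continuousOn_const.mul hexp).neg).mono Icc_subset_Ici_self
    · exact ((continuousOn_const.mul hgc).mul hexp).mono Icc_subset_Ici_self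
    · refine ((((hP.hasDerivAt_phase ht₀ hs.1).const_mul q).neg.exp.const_mul
        (N ^ 2 / q)).neg).congr_deriv ?_
      simp only [Pi.neg_apply]
      field_simp
  have h1 := hd.integral_deriv ht
  have h2 : P.phase t₀ t₀ = 0 := intervalIntegral.integral_same
  rw [h2, mul_zero, neg_zero, Real.exp_zero] at h1
  have h3 : ∫ s in t₀..t, P.weight c θ σ t₀ s ≤
      ∫ s in t₀..t, N ^ 2 * (1 / P.g s) * Real.exp (-(q * P.phase t₀ s)) := by
    refine integral_mono_Icc ht ((hP.continuousOn_weight θ σ ht₀).mono Icc_subset_Ici_self)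
      hd.cont_deriv fun s hs => ?_
    refine mul_le_mul_of_nonneg_right ?_ (Real.exp_nonneg _)
    have hs0 : 0 ≤ s := ht₀.trans hs.1.le
    have hg := hP.one_le_g hs0
    rw [mul_one_div, le_div_iff₀ (by linarith), ← sq]
    exact pow_le_pow_left₀ (by linarith) (hN s hs0) 2
  have h4 : 0 ≤ N ^ 2 / q * Real.exp (-(q * P.phase t₀ t)) := by positivity
  linarith

theorem Assumptions.exists_le_phase (hP : P.Assumptions c)
    (hg : (∫⁻ t in Ioi (0 : ℝ), ENNReal.ofReal (1 / P.g t)) = ⊤) {t₀ : ℝ} (ht₀ : 0 ≤ t₀) (N : ℝ) :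
    ∃ T : ℝ, 0 < T ∧ ∀ t, t₀ + T ≤ t → N ≤ P.phase t₀ t := by
  by_contra! hne
  have hbound : ∀ t, 0 ≤ t → P.phase 0 t ≤ P.phase 0 t₀ + N := by
    intro t ht
    obtain ⟨s, hs, hsN⟩ := hne (t + 1) (by linarith)
    have h1 : t₀ ≤ s := by linarith
    have h2 := hP.phase_add ht₀ h1
    have h3 := hP.phase_mono le_rfl ht (by linarith : t ≤ s)
    linarith
  have hle : (∫⁻ t in Ioi (0 : ℝ), ENNReal.ofReal (1 / P.g t)) ≤
      ENNReal.ofReal (P.phase 0 t₀ + N) := by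
    have hcov : (⋃ n : ℕ, Ioc (0 : ℝ) n) = Ioi 0 := by
      ext s
      simp only [mem_iUnion, mem_Ioc, mem_Ioi]
      exact ⟨fun ⟨n, h, _⟩ => h, fun h => (exists_nat_ge s).imp fun n hn => ⟨h, hn⟩⟩
    have hdir : Directed (· ⊆ ·) fun n : ℕ => Ioc (0 : ℝ) n :=
      Monotone.directed_le fun m n hmn => Ioc_subset_Ioc_right (by exact_mod_cast hmn)
    rw [← hcov, setLIntegral_iUnion_of_directed _ hdir]
    refine iSup_le fun n => ?_
    have hn : (0 : ℝ) ≤ n := Nat.cast_nonneg n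
    have hint := (intervalIntegrable_of_Icc hn
      (hP.continuousOn_one_div_g.mono Icc_subset_Ici_self)).1
    rw [← ofReal_integral_eq_lintegral_ofReal hint
      ((ae_restrict_mem measurableSet_Ioc).mono fun s hs =>
        one_div_nonneg.2 (by linarith [hP.one_le_g (t := s) hs.1.le]))]
    refine ENNReal.ofReal_le_ofReal ?_
    rw [← intervalIntegral.integral_of_le hn]
    exact hbound n hn
  rw [hg] at hle
  exact absurd hle (not_le.2 ENNReal.ofReal_lt_top)

/-! ### Stability -/

/-- The decay estimate for all solutions with sufficiently small initial distance. -/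
theorem Assumptions.exists_decay_of_G (hP : P.Assumptions c) {θ κ σ : ℝ} (hθ : P.θ₂ c < θ)
    (hσ : P.Admissible c θ κ σ) (hG : P.G c θ σ < ⊤) {t₀ : ℝ} (ht₀ : 0 ≤ t₀) (hκ : κ ≤ t₀) :
    ∃ δ S : ℝ, 0 < δ ∧ 0 < S ∧ ∀ u, P.IsSolution t₀ u → P.dist t₀ u t₀ < δ → ∀ t, t₀ ≤ t →
      P.dist t₀ u t < σ ∧
      P.lower θ * P.dist t₀ u t ^ 2 ≤ S * Real.exp (-(P.rate c θ σ * P.phase t₀ t)) := by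
  obtain ⟨S, hS0, hS1, hS2⟩ := hP.exists_threshold hθ hσ.pos
    (mul_nonneg (Real.exp_nonneg (c.ω * P.rate c θ σ / 2 * P.phase 0 t₀))
      (ENNReal.toReal_nonneg (a := P.G c θ σ)))
  have hg := hP.one_le_g ht₀
  have hm := m_nonneg hP.F_smooth hσ.pos.le
  have hγ := hP.θ_add_two_le_γ₃ hθ hσ.pos.le
  have hθ0 := hP.θ_pos hθ
  obtain ⟨δ, hδ0, hδ⟩ := exists_pos_sq_lt hσ.pos
    (show 0 < 2 * ((1 + P.m σ) * (1 + P.γ₃ c θ σ)) * P.g t₀ from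
      mul_pos (mul_pos two_pos (mul_pos (by linarith) (by linarith))) (by linarith)) hS0
  refine ⟨δ, S, hδ0, hS0, fun u hu hd t ht => ?_⟩
  obtain ⟨h1, h2⟩ := hδ _ (Real.sqrt_nonneg _) hd
  obtain ⟨h3, h4⟩ := hu.dist_lt_and_sq_le hP hθ hσ ht₀ hκ
    (fun t ht => hP.mul_integral_weight_le_G hG ht₀ ht) hS0 hS1 hS2 h1 h2 t ht
  exact ⟨h3, h4.trans (mul_le_mul_of_nonneg_right h2.le (Real.exp_nonneg _))⟩

theorem Assumptions.stable (hP : P.Assumptions c) {θ κ ξ σ₀ : ℝ} (hθ : P.θ₂ c < θ)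
    (hξ : P.Admissible c θ κ ξ) (hκ0 : 0 ≤ κ) (hσ₀ : 0 < σ₀) (hG : P.G c θ σ₀ < ⊤) :
    P.Stable κ ξ := by
  intro σ hσ t₀ ht₀
  have hpos : 0 < min σ σ₀ := lt_min hσ.1 hσ₀
  obtain ⟨δ, S, hδ0, -, hδ⟩ := hP.exists_decay_of_G hθ
    (hξ.mono hP hθ hpos ((min_le_left _ _).trans hσ.2))
    ((hP.G_mono hθ hpos.le (min_le_right _ _)).trans_lt hG) (hκ0.trans ht₀) ht₀
  exact ⟨δ, hδ0, fun u hu hd t ht => (hδ u hu hd t ht).1.trans_le (min_le_left _ _)⟩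

theorem Assumptions.asymptoticallyStable (hP : P.Assumptions c) {θ κ ξ σ₀ : ℝ} (hθ : P.θ₂ c < θ)
    (hξ : P.Admissible c θ κ ξ) (hκ0 : 0 ≤ κ) (hσ₀ : 0 < σ₀) (hG : P.G c θ σ₀ < ⊤)
    (hg : (∫⁻ t in Ioi (0 : ℝ), ENNReal.ofReal (1 / P.g t)) = ⊤) :
    P.AsymptoticallyStable κ ξ := by
  refine ⟨hP.stable hθ hξ hκ0 hσ₀ hG, fun t₀ hκ => ?_⟩
  have ht₀ : 0 ≤ t₀ := hκ0.trans hκ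
  have hpos : 0 < min ξ σ₀ := lt_min hξ.pos hσ₀
  obtain ⟨δ, S, hδ0, hS0, hδ⟩ := hP.exists_decay_of_G hθ
    (hξ.mono hP hθ hpos (min_le_left _ _))
    ((hP.G_mono hθ hpos.le (min_le_right _ _)).trans_lt hG) ht₀ hκ
  refine ⟨δ, hδ0, fun ν hν _ _ => ?_⟩
  have hrate := hP.rate_pos hθ hpos.le
  have hχ := lower_pos hP hθ
  -- `T` is such that `S e^{-λ ∫ ds / g} ≤ χ ν² / 2` from `t₀ + T` on
  have hq : 0 < P.lower θ * ν ^ 2 / (2 * S) := by positivity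
  obtain ⟨T, hT0, hT⟩ := hP.exists_le_phase hg ht₀
    (-Real.log (P.lower θ * ν ^ 2 / (2 * S)) / P.rate c θ (min ξ σ₀))
  refine ⟨T, hT0, fun u hu _ hd t ht => ?_⟩
  have h1 := (hδ u hu hd t (by have : t₀ + T ≤ t := ht; linarith)).2
  have h2 := hT t ht
  rw [div_le_iff₀ hrate] at h2
  have h3 : Real.exp (-(P.rate c θ (min ξ σ₀) * P.phase t₀ t)) ≤
      P.lower θ * ν ^ 2 / (2 * S) := by
    rw [← Real.le_log_iff_exp_le hq]
    linarith
  have h4 := mul_le_mul_of_nonneg_left h3 hS0.le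
  have h5 : S * (P.lower θ * ν ^ 2 / (2 * S)) = P.lower θ * ν ^ 2 / 2 := by field_simp
  have h6 : P.lower θ * P.dist t₀ u t ^ 2 < P.lower θ * ν ^ 2 := by
    have : 0 < P.lower θ * ν ^ 2 := by positivity
    linarith
  exact lt_of_pow_lt_pow_left₀ 2 hν.le (lt_of_mul_lt_mul_left h6 hχ.le)

theorem exists_g_le (hg : BddAbove (P.g '' Ioi 0)) :
    ∃ N, ∀ t, 0 ≤ t → P.g t ≤ N := by
  obtain ⟨N, hN⟩ := hg
  refine ⟨max N (P.g 0), fun t ht => ?_⟩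
  rcases eq_or_lt_of_le ht with rfl | h
  · exact le_max_right _ _
  · exact (hN ⟨t, h, rfl⟩).trans (le_max_left _ _)

/-- The decay estimate for bounded `g`, with constants independent of `t₀`. -/
theorem Assumptions.exists_uniform_decay (hP : P.Assumptions c) {θ κ σ N : ℝ} (hθ : P.θ₂ c < θ)
    (hσ : P.Admissible c θ κ σ) (hκ0 : 0 ≤ κ) (hN : ∀ t, 0 ≤ t → P.g t ≤ N) :
    ∃ δ : ℝ, 0 < δ ∧ ∀ t₀, κ ≤ t₀ → ∀ u, P.IsSolution t₀ u → P.dist t₀ u t₀ < δ → ∀ t, t₀ ≤ t →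
      P.dist t₀ u t < σ ∧
      P.lower θ * P.dist t₀ u t ^ 2 ≤
        2 * ((1 + P.m σ) * (1 + P.γ₃ c θ σ)) * N * P.dist t₀ u t₀ ^ 2 *
          Real.exp (-(P.rate c θ σ * ((t - t₀) / N))) := by
  have hm := m_nonneg hP.F_smooth hσ.pos.le
  have hγ := hP.θ_add_two_le_γ₃ hθ hσ.pos.le
  have hθ0 := hP.θ_pos hθ
  have hN1 : 1 ≤ N := (hP.one_le_g le_rfl).trans (hN 0 le_rfl)
  have hrate := hP.rate_pos hθ hσ.pos.le
  obtain ⟨S, hS0, hS1, hS2⟩ := hP.exists_threshold hθ hσ.pos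
    (show 0 ≤ c.h * (N ^ 2 / (c.ω * P.rate c θ σ / 2)) from
      mul_nonneg hP.h_nonneg (div_nonneg (sq_nonneg _)
        (half_pos (mul_pos hP.ω_pos hrate)).le))
  have hK : 0 < 2 * ((1 + P.m σ) * (1 + P.γ₃ c θ σ)) :=
    mul_pos two_pos (mul_pos (by linarith) (by linarith))
  obtain ⟨δ, hδ0, hδ⟩ := exists_pos_sq_lt hσ.pos (mul_pos hK (by linarith : 0 < N)) hS0
  refine ⟨δ, hδ0, fun t₀ hκ u hu hd t ht => ?_⟩
  have ht₀ : 0 ≤ t₀ := hκ0.trans hκ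
  obtain ⟨h1, h2⟩ := hδ _ (Real.sqrt_nonneg _) hd
  have h3 : 2 * ((1 + P.m σ) * (1 + P.γ₃ c θ σ)) * P.g t₀ * P.dist t₀ u t₀ ^ 2 ≤
      2 * ((1 + P.m σ) * (1 + P.γ₃ c θ σ)) * N * P.dist t₀ u t₀ ^ 2 :=
    mul_le_mul_of_nonneg_right (mul_le_mul_of_nonneg_left (hN t₀ ht₀) hK.le) (sq_nonneg _)
  obtain ⟨h4, h5⟩ := hu.dist_lt_and_sq_le hP hθ hσ ht₀ hκ
    (fun t ht => hP.mul_integral_weight_le_of_g_le hθ hσ.pos.le hN ht₀ ht) hS0 hS1 hS2 h1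
    (h3.trans_lt h2) t ht
  refine ⟨h4, h5.trans (mul_le_mul h3 (Real.exp_le_exp.2 (neg_le_neg ?_)) (Real.exp_nonneg _)
    (mul_nonneg (mul_nonneg hK.le (by linarith)) (sq_nonneg _)))⟩
  refine mul_le_mul_of_nonneg_left ?_ hrate.le
  have h6 : ∫ _ in t₀..t, 1 / N ≤ P.phase t₀ t := by
    refine integral_mono_Icc ht continuousOn_const
      (hP.continuousOn_one_div_g.mono fun s hs => ht₀.trans hs.1) fun s hs => ?_
    have hs0 : 0 ≤ s := ht₀.trans hs.1.le
    exact one_div_le_one_div_of_le (by linarith [hP.one_le_g hs0]) (hN s hs0)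
  rwa [intervalIntegral.integral_const, smul_eq_mul, mul_one_div] at h6

theorem Assumptions.uniformlyStable (hP : P.Assumptions c) {θ κ ξ : ℝ} (hθ : P.θ₂ c < θ)
    (hξ : P.Admissible c θ κ ξ) (hκ0 : 0 ≤ κ) (hg : BddAbove (P.g '' Ioi 0)) :
    P.UniformlyStable κ ξ := by
  intro σ hσ
  obtain ⟨N, hN⟩ := exists_g_le hg
  obtain ⟨δ, hδ0, hδ⟩ := hP.exists_uniform_decay hθ (hξ.mono hP hθ hσ.1 hσ.2) hκ0 hN
  exact ⟨δ, hδ0, fun t₀ hκ u hu hd t ht => (hδ t₀ hκ u hu hd t ht).1⟩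

theorem Assumptions.uniformlyExpStable (hP : P.Assumptions c) {θ κ ξ : ℝ} (hθ : P.θ₂ c < θ)
    (hξ : P.Admissible c θ κ ξ) (hκ0 : 0 ≤ κ) (hg : BddAbove (P.g '' Ioi 0)) :
    P.UniformlyExpStable κ := by
  obtain ⟨N, hN⟩ := exists_g_le hg
  obtain ⟨δ, hδ0, hδ⟩ := hP.exists_uniform_decay hθ hξ hκ0 hN
  have hm := m_nonneg hP.F_smooth hξ.pos.le
  have hγ := hP.θ_add_two_le_γ₃ hθ hξ.pos.le
  have hθ0 := hP.θ_pos hθ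
  have hN1 : 1 ≤ N := (hP.one_le_g le_rfl).trans (hN 0 le_rfl)
  have hrate := hP.rate_pos hθ hξ.pos.le
  have hχ := lower_pos hP hθ
  have hK : 0 < 2 * ((1 + P.m ξ) * (1 + P.γ₃ c θ ξ)) * N :=
    mul_pos (mul_pos two_pos (mul_pos (by linarith) (by linarith))) (by linarith)
  set K := 2 * ((1 + P.m ξ) * (1 + P.γ₃ c θ ξ)) * N
  refine ⟨δ, Real.sqrt (K / P.lower θ), P.rate c θ ξ / (2 * N), hδ0,
    Real.sqrt_pos.2 (div_pos hK hχ), by positivity, fun t₀ hκ u hu hd t ht => ?_⟩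
  have h1 := (hδ t₀ hκ u hu hd t ht).2
  have hd0 : 0 ≤ P.dist t₀ u t₀ := Real.sqrt_nonneg _
  refine abs_le_of_sq_le_sq (a := P.dist t₀ u t) ?_ (by positivity) |>.trans' (le_abs_self _)
  have h2 : Real.exp (-(P.rate c θ ξ / (2 * N) * (t - t₀))) ^ 2 =
      Real.exp (-(P.rate c θ ξ * ((t - t₀) / N))) := by
    rw [sq, ← Real.exp_add]
    congr 1
    have : N ≠ 0 := by linarith
    field_simp
    ring
  rw [mul_pow, mul_pow, Real.sq_sqrt (div_pos hK hχ).le, h2]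
  have h3 : K / P.lower θ * Real.exp (-(P.rate c θ ξ * ((t - t₀) / N))) * P.dist t₀ u t₀ ^ 2 =
      K * P.dist t₀ u t₀ ^ 2 * Real.exp (-(P.rate c θ ξ * ((t - t₀) / N))) / P.lower θ := by
    ring
  rw [h3, le_div_iff₀ hχ, mul_comm]
  exact h1

end Problem

end StrongDamping

end

theorem theorem1 (P : StrongDamping.Problem) (c : StrongDamping.Constants)
    (hP : P.Assumptions c)
    (hC : (∀ t ∈ Ici (0 : ℝ), StrongDamping.ddt P.C t ≤ 0) ∨
      Tendsto (StrongDamping.ddt P.C) atTop (𝓝 0))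
    (θ : ℝ) (hθ : P.θ₂ c < θ) :
    ∃ κ ξ : ℝ, 0 ≤ κ ∧ 0 < ξ ∧
      ((∀ t ∈ Ici (0 : ℝ), StrongDamping.ddt P.C t ≤ 0) → κ = 0) ∧
      (0 < P.σM' c θ → P.Stable κ ξ) ∧
      (0 < P.σM' c θ → (∫⁻ t in Ioi (0 : ℝ), ENNReal.ofReal (1 / P.g t)) = ⊤ →
        P.AsymptoticallyStable κ ξ) ∧
      (BddAbove (P.g '' Ioi 0) → P.UniformlyStable κ ξ ∧ P.UniformlyExpStable κ) := by
  obtain ⟨κ, ξ, hκ0, hκ, hξ⟩ := hP.exists_admissible hθ hC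
  have hσ : 0 < P.σM' c θ → ∃ σ, 0 < σ ∧ P.G c θ σ < ⊤ := by
    intro h
    obtain ⟨_, ⟨σ, hσ, rfl⟩, -⟩ := lt_sSup_iff.1 h
    exact ⟨σ, hσ⟩
  refine ⟨κ, ξ, hκ0, hξ.pos, hκ, fun h => ?_, fun h hg => ?_, fun hg => ⟨?_, ?_⟩⟩
  · obtain ⟨σ, hσ0, hG⟩ := hσ h
    exact hP.stable hθ hξ hκ0 hσ0 hG
  · obtain ⟨σ, hσ0, hG⟩ := hσ h
    exact hP.asymptoticallyStable hθ hξ hκ0 hσ0 hG hg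
  · exact hP.uniformlyStable hθ hξ hκ0 hg
  · exact hP.uniformlyExpStable hθ hξ hκ0 hg
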